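/- Let $W_4$ be the 4-wheel (a hub joined to all four vertices of a 4-cycle, the rim). Let $(G,t)$ be $W_4$ with a root vertex $t$ inserted at the midpoint of a rim edge, and let $(H,u,v)$ be $W_4$ with root vertices $u$ and $v$ inserted at the midpoints of two non-adjacent rim edges. The $W_4$-chains are the rooted graphs $(X_n,v_n)$, $n\ge 0$, given by $(X_0,v_0)=(G,t)$ and $(X_{n+1},v_{n+1})=(X_n,v_n)*(H,u,v)$: take the disjoint union of $X_n$ and a new copy of $H$, merge $v_n$ with $u$, and let the copy of $v$ be the new root $v_{n+1}$. For a finite connected graph $X$ with a 2-valent root vertex $y$, let $g_i(X)$ be the number of combinatorially distinct cellular embeddings of $X$ in the oriented surface of genus $i$ (that is, of rotation systems of $X$ of genus $i$); let $d_i(X,y)$ be the number of those embeddings in which two different face-boundary walks are incident on $y$, and $s_i(X,y)$ the number of those in which a single face-boundary walk is twice incident on $y$. Then for every $n\ge 0$: (a) the genus distribution $(g_i(X_n))_{i\ge0}$ is log-concave; (b) the single-root partial genus distributions $D=(d_i(X_n,v_n))_{i\ge0}$ and $S=(s_i(X_n,v_n))_{i\ge0}$ are log-concave; (c) $D$ and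 $S$ are synchronized: they are log-concave and satisfy $d_{k-1}s_{k+1}\le d_ks_k$ and $d_{k+1}s_{k-1}\le d_ks_k$ for all $k$. Moreover, none of these three sequences has internal zeros. (A sequence $(a_k)$ is log-concave if $a_{k-1}a_{k+1}\le a_k^2$ for all $k$; terms with negative index are $0$.) -/

import Mathlib

namespace GraphEmbedding

section Embeddings

variable {V : Type*} (G : SimpleGraph V)

/-- A rotation system of a graph: a permutation of the darts (directed edges) whose cycles are
exactly the sets of darts leaving a common vertex, i.e. a cyclic ordering of the darts at every
vertex. For a finite connected graph, the rotation systems are the combinatorially distinct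
cellular embeddings of the (labelled) graph in oriented surfaces. -/
def IsRotationSystem (ρ : Equiv.Perm G.Dart) : Prop :=
  ∀ d e : G.Dart, ρ.SameCycle d e ↔ d.fst = e.fst

variable {G}

/-- The face-tracing permutation of a rotation system: traverse the dart `d`, then leave its end
vertex along the dart that follows the reversal of `d` in the rotation there. Its cycles are the
face-boundary walks. -/
def facePerm (ρ : Equiv.Perm G.Dart) : Equiv.Perm G.Dart :=
  ρ * Function.Involutive.toPerm SimpleGraph.Dart.symm SimpleGraph.Dart.symm_involutive

/-- The number of faces, i.e. of cycles (fixed points included) of the face-tracing permutation. -/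
noncomputable def numFaces (ρ : Equiv.Perm G.Dart) : ℕ :=
  Nat.card (Quotient (Equiv.Perm.SameCycle.setoid (facePerm ρ)))

/-- The embedding has genus `i`: Euler's formula `|V| - |E| + |F| = 2 - 2 i`, for a finite
connected graph with at least one edge. -/
def HasGenus (ρ : Equiv.Perm G.Dart) (i : ℕ) : Prop :=
  Nat.card V + numFaces ρ + 2 * i = Nat.card G.edgeSet + 2

/-- Two different face-boundary walks are incident on the (2-valent) vertex `y`. A face-boundary
walk passes through `y` exactly when it leaves `y` along some dart. -/
def RootOnTwoFaces (ρ : Equiv.Perm G.Dart) (y : V) : Prop :=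
  ∃ d e : G.Dart, d.fst = y ∧ e.fst = y ∧ ¬ (facePerm ρ).SameCycle d e

/-- A single face-boundary walk is twice incident on the (2-valent) vertex `y`. -/
def RootOnOneFace (ρ : Equiv.Perm G.Dart) (y : V) : Prop :=
  ∀ d e : G.Dart, d.fst = y → e.fst = y → (facePerm ρ).SameCycle d e

variable (G)

/-- The genus distribution `g_i(G)`: the number of embeddings of `G` of genus `i`. -/
noncomputable def genusDistribution (i : ℕ) : ℕ :=
  Nat.card {ρ : Equiv.Perm G.Dart // IsRotationSystem G ρ ∧ HasGenus ρ i}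

/-- The partial genus distribution `d_i(G, y)`. -/
noncomputable def partialD (y : V) (i : ℕ) : ℕ :=
  Nat.card {ρ : Equiv.Perm G.Dart // IsRotationSystem G ρ ∧ HasGenus ρ i ∧ RootOnTwoFaces ρ y}

/-- The partial genus distribution `s_i(G, y)`. -/
noncomputable def partialS (y : V) (i : ℕ) : ℕ :=
  Nat.card {ρ : Equiv.Perm G.Dart // IsRotationSystem G ρ ∧ HasGenus ρ i ∧ RootOnOneFace ρ y}

end Embeddings

section Amalgamation

/-- A finite graph with a root vertex. -/
structure RootedGraph where
  V : Type
  finite : Finite V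
  graph : SimpleGraph V
  root : V

/-- A finite graph with two distinct root vertices. -/
structure DoublyRootedGraph where
  V : Type
  finite : Finite V
  graph : SimpleGraph V
  fstRoot : V
  sndRoot : V
  ne : sndRoot ≠ fstRoot

variable (X : RootedGraph) (H : DoublyRootedGraph)

/-- The vertices of the disjoint union `X ⊔ H` after the root of `X` and the first root of `H`
have been merged (the merged vertex is kept on the side of `X`). -/
abbrev AmalgamVertex : Type := X.V ⊕ {w : H.V // w ≠ H.fstRoot}

/-- The inclusion of the vertices of `X` in the amalgamated graph. -/
def amalgamLeft : X.V ↪ AmalgamVertex X H := ⟨Sum.inl, Sum.inl_injective⟩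

open Classical in
/-- The inclusion of the vertices of `H` in the amalgamated graph: the first root goes to the
root of `X`. -/
noncomputable def amalgamRight : H.V ↪ AmalgamVertex X H where
  toFun w := if h : w = H.fstRoot then Sum.inl X.root else Sum.inr ⟨w, h⟩
  inj' := by
    intro a b hab
    by_cases ha : a = H.fstRoot <;> by_cases hb : b = H.fstRoot <;> simp_all

/-- Vertex-amalgamation `(X, t) * (H, u, v)`: the root `t` of `X` is merged with the first root `u`
of `H`, and the second root `v` of `H` is the root of the result. -/
noncomputable def amalgamate : RootedGraph where
  V := AmalgamVertex X H
  finite := by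
    have := X.finite
    have := H.finite
    infer_instance
  graph := X.graph.map (amalgamLeft X H) ⊔ H.graph.map (amalgamRight X H)
  root := Sum.inr ⟨H.sndRoot, H.ne⟩

end Amalgamation

section WheelChains

/-- The 4-wheel (hub `0`, rim cycle `1, 2, 3, 4`) with a root vertex `5` inserted at the midpoint
of the rim edge `12`. -/
def wheelRooted : RootedGraph where
  V := Fin 6
  finite := inferInstance
  graph := SimpleGraph.fromEdgeSet
    {s(0, 1), s(0, 2), s(0, 3), s(0, 4), s(1, 5), s(5, 2), s(2, 3), s(3, 4), s(4, 1)}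
  root := 5

/-- The 4-wheel (hub `0`, rim cycle `1, 2, 3, 4`) with root vertices `5` and `6` inserted at the
midpoints of the non-adjacent rim edges `12` and `34`. -/
def wheelDoublyRooted : DoublyRootedGraph where
  V := Fin 7
  finite := inferInstance
  graph := SimpleGraph.fromEdgeSet
    {s(0, 1), s(0, 2), s(0, 3), s(0, 4), s(1, 5), s(5, 2), s(2, 3), s(3, 6), s(6, 4), s(4, 1)}
  fstRoot := 5
  sndRoot := 6
  ne := by decide

/-- The `W₄`-chain `(G, t) * (H, u, v) * ⋯ * (H, u, v)` with `n` amalgamations, where `(G, t)` and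
`(H, u, v)` are the rooted and the doubly rooted 4-wheel; it consists of `n + 1` wheels. -/
noncomputable def wheelChain : ℕ → RootedGraph
  | 0 => wheelRooted
  | n + 1 => amalgamate (wheelChain n) wheelDoublyRooted

end WheelChains

section Sequences

/-- No internal zeros. -/
def NoInternalZeros (a : ℕ → ℕ) : Prop :=
  ∀ i k j : ℕ, i < k → k < j → a i ≠ 0 → a j ≠ 0 → a k ≠ 0

/-- Log-concavity of a nonnegative sequence, extended by zero to negative indices (where the
inequality is trivial). -/
def LogConcave (a : ℕ → ℕ) : Prop :=
  ∀ k : ℕ, a k * a (k + 2) ≤ a (k + 1) ^ 2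

/-- Synchronicity `A ∼ B`: both sequences are log-concave, and
`a_{k-1} b_{k+1} ≤ a_k b_k` and `a_{k+1} b_{k-1} ≤ a_k b_k` for all `k`. -/
def Synchronized (a b : ℕ → ℕ) : Prop :=
  LogConcave a ∧ LogConcave b ∧
    ∀ k : ℕ, a k * b (k + 2) ≤ a (k + 1) * b (k + 1) ∧ a (k + 2) * b k ≤ a (k + 1) * b (k + 1)

end Sequences

end GraphEmbedding

/-!
Why the partial genus distributions of the `W₄`-chains are synchronized.

*Faces of an amalgamation.* Let `φ` and `ψ` be the face permutations of embeddings of `X` and `H`,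
and let `a₀, a₁` and `b₀, b₁` be the darts at the two 2-valent roots that are merged. A rotation
system of `X * H` consists of rotation systems of `X` and `H` and one of the six cyclic orders of
`a₀, a₁, b₀, b₁` (`amalgamRotation_bijective`), and its face permutation is `μ * (φ ⊕ ψ)`, where `μ`
is a transposition `(aᵢ bⱼ)` for the four orders in which the two pairs do not interlace, and a
4-cycle for the other two (`gluing`). A transposition merges one face of `X` with one face of `H`,
so the genus is additive and the type of the new root is unchanged. A 4-cycle can be written both as
`(a₀ bᵢ) (a₁ bⱼ) (b₀ b₁)` and as `(a₀ bⱼ) (a₁ bᵢ) (a₀ a₁)`. If `a₀` and `a₁` lie on different cycles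
of `φ`, the first form shows that the two bridges `(a bᵢ)` only merge cycles of `φ` with cycles of
`(b₀ b₁) * ψ`. If they lie on one cycle, the second form shows the same for `(a₀ a₁) * φ`, in which
this cycle is split, and `ψ`. In both cases the faces and the type of the new root can be read off
from `ψ` and `(b₀ b₁) * ψ` alone (`TransferData`), which gives a linear recursion for the pair of
partial genus distributions (`TransferData.partialCount_amalgamate`).

*The coefficients.* Each of the two subdivided wheels has 96 rotation systems. Counting cycles for
all of them gives the initial values `D = 2 + 44 x`, `S = 14 x + 36 x²`
(`partialCount_wheelRooted`) and the recursion `D' = (8 + 208 x + 64 x²) D + (12 + 264 x) S`,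
`S' = (56 x + 240 x²) D + (84 x + 216 x²) S` (`partialCount_amalgamate_wheel`).

*Log-concavity.* The invariant is that `D`, `S`, `x D` increase in the likelihood-ratio order and
have the supports `[0, N]`, `[1, N + 1]`, `[1, N + 1]` (`Interlaced`). Then all minors of order 2 of
the matrix with the rows `D, S, x D, x S, x² D, …` are nonnegative. The relevant minors of the
coefficient matrix are nonnegative as well, so the Cauchy–Binet formula carries the invariant over
to `D'` and `S'` (`Interlaced.step`). Comparing `D` with `x D`, `S` with `x S`, `S` with `x D` and
`D` with `x S` gives log-concavity and synchronicity; the sum of synchronized sequences is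
log-concave.
-/

namespace GraphEmbedding

open Equiv Equiv.Perm

/-! ### Cycles of permutations -/

section Cycles

variable {α β : Type*}

/-- The number of cycles of a permutation, fixed points included. -/
noncomputable def numCycles (σ : Perm α) : ℕ :=
  Nat.card (Quotient (SameCycle.setoid σ))

theorem SameCycle.induction [Finite α] {σ : Perm α} {p : α → Prop} {x y : α}
    (h : σ.SameCycle x y) (hx : p x) (hp : ∀ z, p z → p (σ z)) : p y := by
  obtain ⟨n, rfl⟩ := h.exists_nat_pow_eq
  clear h
  induction n with
  | zero => simpa
  | succ n ih =>
    rw [pow_succ', Perm.mul_apply]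
    exact hp _ ih

/-- The cycle relation is the least equivalence relation containing the pairs `(x, σ x)`. -/
theorem SameCycle.rel [Finite α] {σ : Perm α} (r : Setoid α) (hr : ∀ z, r z (σ z)) {x y : α}
    (h : σ.SameCycle x y) : r x y :=
  SameCycle.induction (p := fun z => r x z) h (r.refl x) fun z hz => r.trans hz (hr z)

/-- Two permutations that agree on an invariant set have the same cycles there. -/
theorem SameCycle.congr_on [Finite α] {σ τ : Perm α} {p : α → Prop}
    (hp : ∀ z, p z → p (σ z) ∧ τ z = σ z) {x y : α} (hx : p x) (h : σ.SameCycle x y) :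
    τ.SameCycle x y := by
  refine (SameCycle.induction (p := fun z => p z ∧ τ.SameCycle x z) h ⟨hx, .refl _ _⟩ ?_).2
  rintro z ⟨hz, hxz⟩
  refine ⟨(hp z hz).1, ?_⟩
  rw [← (hp z hz).2]
  exact sameCycle_apply_right.2 hxz

/-- If `μ` only moves elements inside cycles of `μ * σ`, then every cycle of `σ` is contained in
a cycle of `μ * σ`. -/
theorem SameCycle.mul_left_of_forall [Finite α] {σ μ : Perm α}
    (hμ : ∀ z, (μ * σ).SameCycle z (μ z)) {x y : α} (h : σ.SameCycle x y) :
    (μ * σ).SameCycle x y := by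
  refine SameCycle.rel (SameCycle.setoid (μ * σ)) (fun z => ?_) h
  have h1 : (μ * σ).SameCycle z (μ (σ z)) := sameCycle_apply_right.2 (.refl _ _)
  exact h1.trans (hμ _).symm

theorem sameCycle_swap_mul_of_sameCycle [Finite α] [DecidableEq α] {σ : Perm α} {a b x y : α}
    (hab : (swap a b * σ).SameCycle a b) (h : σ.SameCycle x y) :
    (swap a b * σ).SameCycle x y := by
  refine SameCycle.mul_left_of_forall (fun z => ?_) h
  by_cases hza : z = a
  · subst hza; simpa using hab
  by_cases hzb : z = b
  · subst hzb; simpa using hab.symm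
  rw [swap_apply_of_ne_of_ne hza hzb]

theorem sameCycle_swap_mul_self_of_not [Finite α] [DecidableEq α] {σ : Perm α} {a b : α}
    (hab : ¬ σ.SameCycle a b) : (swap a b * σ).SameCycle a b := by
  have key : ∀ y, σ.SameCycle a y → σ.SameCycle a y ∧ (swap a b * σ).SameCycle a y := by
    intro y hy
    refine SameCycle.induction (p := fun y => σ.SameCycle a y ∧ (swap a b * σ).SameCycle a y) hy
      ⟨.refl _ _, .refl _ _⟩ ?_
    rintro z ⟨hz, hz'⟩
    have hz1 : σ.SameCycle a (σ z) := sameCycle_apply_right.2 hz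
    refine ⟨hz1, ?_⟩
    by_cases hza : σ z = a
    · rw [hza]
    have hzb : σ z ≠ b := fun h => hab (h ▸ hz1)
    have : (swap a b * σ) z = σ z := by
      rw [Perm.mul_apply, swap_apply_of_ne_of_ne hza hzb]
    rw [← this]
    exact sameCycle_apply_right.2 hz'
  have h1 := (key (σ.symm a) (sameCycle_symm_apply_right.2 (.refl _ _))).2
  have h2 : (swap a b * σ) (σ.symm a) = b := by simp
  have h3 := sameCycle_apply_right.2 h1
  rwa [h2] at h3

/-- Multiplying by a transposition of elements of two different cycles merges these cycles. -/
theorem sameCycle_swap_mul_iff [Finite α] [DecidableEq α] {σ : Perm α} {a b : α}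
    (hab : ¬ σ.SameCycle a b) (x y : α) :
    (swap a b * σ).SameCycle x y ↔ σ.SameCycle x y ∨
      (σ.SameCycle x a ∧ σ.SameCycle y b) ∨ (σ.SameCycle x b ∧ σ.SameCycle y a) := by
  have h1 := sameCycle_swap_mul_self_of_not hab
  constructor
  · intro h
    refine SameCycle.induction (p := fun y => σ.SameCycle x y ∨
      (σ.SameCycle x a ∧ σ.SameCycle y b) ∨ (σ.SameCycle x b ∧ σ.SameCycle y a)) h
      (.inl (.refl _ _)) ?_
    intro z hz
    rw [Perm.mul_apply]
    by_cases hza : σ z = a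
    · have hza' : σ.SameCycle z a := by rw [← hza]; exact sameCycle_apply_right.2 (.refl _ _)
      rw [hza, swap_apply_left]
      rcases hz with hz | ⟨hz, hz'⟩ | ⟨hz, hz'⟩
      · exact .inr (.inl ⟨hz.trans hza', .refl _ _⟩)
      · exact absurd (hza'.symm.trans hz') hab
      · exact .inl hz
    by_cases hzb : σ z = b
    · have hzb' : σ.SameCycle z b := by rw [← hzb]; exact sameCycle_apply_right.2 (.refl _ _)
      rw [hzb, swap_apply_right]
      rcases hz with hz | ⟨hz, hz'⟩ | ⟨hz, hz'⟩
      · exact .inr (.inr ⟨hz.trans hzb', .refl _ _⟩)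
      · exact .inl hz
      · exact absurd (hz'.symm.trans hzb') hab
    rw [swap_apply_of_ne_of_ne hza hzb]
    simpa only [sameCycle_apply_left, sameCycle_apply_right] using hz
  · rintro (h | ⟨h, h'⟩ | ⟨h, h'⟩)
    · exact sameCycle_swap_mul_of_sameCycle h1 h
    · exact (sameCycle_swap_mul_of_sameCycle h1 h).trans
        (h1.trans (sameCycle_swap_mul_of_sameCycle h1 h').symm)
    · exact (sameCycle_swap_mul_of_sameCycle h1 h).trans
        (h1.symm.trans (sameCycle_swap_mul_of_sameCycle h1 h').symm)

theorem numCycles_swap_mul_add_one [Finite α] [DecidableEq α] {σ : Perm α} {a b : α}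
    (hab : ¬ σ.SameCycle a b) : numCycles (swap a b * σ) + 1 = numCycles σ := by
  classical
  -- Away from the class of `b`, the cycles of `swap a b * σ` are those of `σ`.
  let f : {q : Quotient (SameCycle.setoid σ) // q ≠ Quotient.mk _ b} →
      Quotient (SameCycle.setoid (swap a b * σ)) := fun q =>
    Quotient.map' id (fun x y h => sameCycle_swap_mul_of_sameCycle
      (sameCycle_swap_mul_self_of_not hab) h) q.1
  have hf : Function.Bijective f := by
    constructor
    · rintro ⟨p, hp⟩ ⟨q, hq⟩ h
      induction p using Quotient.inductionOn with | _ x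
      induction q using Quotient.inductionOn with | _ y
      have hx : ¬ σ.SameCycle x b := fun h => hp (Quotient.sound h)
      have hy : ¬ σ.SameCycle y b := fun h => hq (Quotient.sound h)
      have h' : (swap a b * σ).SameCycle x y := Quotient.exact h
      rw [sameCycle_swap_mul_iff hab] at h'
      refine Subtype.ext (Quotient.sound ?_)
      exact h'.resolve_right (by tauto)
    · intro q
      induction q using Quotient.inductionOn with | _ x
      by_cases hx : σ.SameCycle x b
      · refine ⟨⟨Quotient.mk _ a, fun h => hab (Quotient.exact h)⟩, Quotient.sound ?_⟩
        exact (sameCycle_swap_mul_iff hab _ _).2 (.inr (.inl ⟨.refl _ _, hx⟩))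
      · exact ⟨⟨Quotient.mk _ x, fun h => hx (Quotient.exact h)⟩, rfl⟩
  have h1 : numCycles (swap a b * σ) =
      Nat.card {q : Quotient (SameCycle.setoid σ) // q ≠ Quotient.mk _ b} :=
    (Nat.card_congr (Equiv.ofBijective f hf)).symm
  have h2 := Nat.card_congr (Equiv.sumCompl
    (fun q : Quotient (SameCycle.setoid σ) => q = Quotient.mk _ b))
  rw [Nat.card_sum, Nat.card_unique] at h2
  rw [h1, numCycles, ← h2, add_comm]

/-- Multiplying by a transposition of two elements of one cycle splits this cycle. -/
theorem not_sameCycle_swap_mul [Finite α] [DecidableEq α] {σ : Perm α} {a b : α} (hne : a ≠ b)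
    (hab : σ.SameCycle a b) : ¬ (swap a b * σ).SameCycle a b := by
  have hex : ∃ i : ℕ, (σ ^ (i + 1)) a = b := by
    obtain ⟨n, hn⟩ := hab.exists_nat_pow_eq
    cases n with
    | zero => exact absurd hn hne
    | succ n => exact ⟨n, hn⟩
  classical
  obtain ⟨i, hi, hmin⟩ : ∃ i : ℕ, (σ ^ (i + 1)) a = b ∧ ∀ j < i, (σ ^ (j + 1)) a ≠ b :=
    ⟨Nat.find hex, Nat.find_spec hex, fun j hj => Nat.find_min hex hj⟩
  intro h
  -- The segment from `a` to the element before `b` is closed under `swap a b * σ`.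
  have hclosed : ∃ j ≤ i, b = (σ ^ j) a := by
    refine SameCycle.induction (p := fun z => ∃ j ≤ i, z = (σ ^ j) a) h ⟨0, Nat.zero_le _, rfl⟩ ?_
    rintro z ⟨j, hj, rfl⟩
    have hs : σ ((σ ^ j) a) = (σ ^ (j + 1)) a := by rw [pow_succ', Perm.mul_apply]
    rw [Perm.mul_apply, hs]
    rcases hj.eq_or_lt with rfl | hj
    · exact ⟨0, Nat.zero_le _, by rw [hi, swap_apply_right]; rfl⟩
    · refine ⟨j + 1, hj, swap_apply_of_ne_of_ne (fun hja => ?_) (hmin j hj)⟩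
      refine hmin (i - (j + 1)) (by omega) ?_
      have : i + 1 = (i - (j + 1) + 1) + (j + 1) := by omega
      rw [this, pow_add, Perm.mul_apply, hja] at hi
      exact hi
  obtain ⟨j, hj, hb⟩ := hclosed
  cases j with
  | zero => exact hne hb.symm
  | succ j => exact hmin j hj hb.symm

theorem numCycles_swap_mul_of_sameCycle [Finite α] [DecidableEq α] {σ : Perm α} {a b : α}
    (hne : a ≠ b) (hab : σ.SameCycle a b) : numCycles (swap a b * σ) = numCycles σ + 1 := by
  rw [← numCycles_swap_mul_add_one (not_sameCycle_swap_mul hne hab), swap_mul_self_mul]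

theorem sameCycle_permCongr (e : α ≃ β) (σ : Perm α) (x y : β) :
    (e.permCongr σ).SameCycle x y ↔ σ.SameCycle (e.symm x) (e.symm y) := by
  have h : ∀ n : ℤ, (e.permCongr σ ^ n) x = e ((σ ^ n) (e.symm x)) := fun n => by
    have : e.permCongr σ ^ n = e.permCongr (σ ^ n) := (map_zpow e.permCongrHom σ n).symm
    rw [this]; rfl
  simp only [SameCycle, h, ← Equiv.eq_symm_apply]

theorem numCycles_permCongr (e : α ≃ β) (σ : Perm α) :
    numCycles (e.permCongr σ) = numCycles σ :=
  (Nat.card_congr (Quotient.congr (ra := SameCycle.setoid σ)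
    (rb := SameCycle.setoid (e.permCongr σ)) e fun x y => by
      change σ.SameCycle x y ↔ (e.permCongr σ).SameCycle (e x) (e y)
      simp [sameCycle_permCongr])).symm

theorem sumCongr_zpow (σ : Perm α) (τ : Perm β) (n : ℤ) :
    (Equiv.Perm.sumCongr σ τ) ^ n = Equiv.Perm.sumCongr (σ ^ n) (τ ^ n) :=
  (map_zpow (sumCongrHom α β) (σ, τ) n).symm

@[simp]
theorem sameCycle_sumCongr_inl (σ : Perm α) (τ : Perm β) (x y : α) :
    (Equiv.Perm.sumCongr σ τ).SameCycle (.inl x) (.inl y) ↔ σ.SameCycle x y := by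
  simp [SameCycle, sumCongr_zpow]

@[simp]
theorem sameCycle_sumCongr_inr (σ : Perm α) (τ : Perm β) (x y : β) :
    (Equiv.Perm.sumCongr σ τ).SameCycle (.inr x) (.inr y) ↔ τ.SameCycle x y := by
  simp [SameCycle, sumCongr_zpow]

@[simp]
theorem not_sameCycle_sumCongr_inl_inr (σ : Perm α) (τ : Perm β) (x : α) (y : β) :
    ¬ (Equiv.Perm.sumCongr σ τ).SameCycle (.inl x) (.inr y) := by
  simp [SameCycle, sumCongr_zpow]

@[simp]
theorem not_sameCycle_sumCongr_inr_inl (σ : Perm α) (τ : Perm β) (x : α) (y : β) :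
    ¬ (Equiv.Perm.sumCongr σ τ).SameCycle (.inr y) (.inl x) := by
  simp [SameCycle, sumCongr_zpow]

theorem numCycles_sumCongr [Finite α] [Finite β] (σ : Perm α) (τ : Perm β) :
    numCycles (Equiv.Perm.sumCongr σ τ) = numCycles σ + numCycles τ := by
  let f : Quotient (SameCycle.setoid σ) ⊕ Quotient (SameCycle.setoid τ) →
      Quotient (SameCycle.setoid (Equiv.Perm.sumCongr σ τ)) := Sum.elim
    (Quotient.map' Sum.inl fun x y h => (sameCycle_sumCongr_inl σ τ x y).2 h)
    (Quotient.map' Sum.inr fun x y h => (sameCycle_sumCongr_inr σ τ x y).2 h)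
  have hf : Function.Bijective f := by
    constructor
    · rintro (p | p) (q | q) h <;>
      induction p using Quotient.inductionOn with | _ x <;>
      induction q using Quotient.inductionOn with | _ y <;>
      have h' := Quotient.exact h
      · exact congrArg _ (Quotient.sound ((sameCycle_sumCongr_inl σ τ x y).1 h'))
      · exact absurd h' (not_sameCycle_sumCongr_inl_inr σ τ x y)
      · exact absurd h' (not_sameCycle_sumCongr_inr_inl σ τ y x)
      · exact congrArg _ (Quotient.sound ((sameCycle_sumCongr_inr σ τ x y).1 h'))
    · intro q
      induction q using Quotient.inductionOn with | _ x
      rcases x with x | x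
      · exact ⟨.inl (Quotient.mk _ x), rfl⟩
      · exact ⟨.inr (Quotient.mk _ x), rfl⟩
  rw [numCycles, ← Nat.card_congr (Equiv.ofBijective f hf), Nat.card_sum]
  rfl

/-- One transposition across a disjoint sum merges two cycles, and changes no relation inside
the second summand. -/
theorem sameCycle_bridge [Finite α] [Finite β] [DecidableEq α] [DecidableEq β] (σ : Perm α)
    (τ : Perm β) (a : α) (b : β) (x y : β) :
    (swap (Sum.inl a) (Sum.inr b) * Equiv.Perm.sumCongr σ τ).SameCycle (.inr x) (.inr y) ↔
      τ.SameCycle x y := by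
  rw [sameCycle_swap_mul_iff (by simp)]
  simp

theorem numCycles_bridge [Finite α] [Finite β] [DecidableEq α] [DecidableEq β] (σ : Perm α)
    (τ : Perm β) (a : α) (b : β) :
    numCycles (swap (Sum.inl a) (Sum.inr b) * Equiv.Perm.sumCongr σ τ) + 1 =
      numCycles σ + numCycles τ := by
  rw [numCycles_swap_mul_add_one (by simp), numCycles_sumCongr]

/-- The endpoints of the second of two bridges lie on different cycles if the two bridges end on
different cycles of the first summand. -/
theorem not_sameCycle_bridge [Finite α] [Finite β] [DecidableEq α] [DecidableEq β] {σ : Perm α}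
    (τ : Perm β) {a a' : α} (b b' : β) (ha : ¬ σ.SameCycle a a') :
    ¬ (swap (Sum.inl a') (Sum.inr b') * Equiv.Perm.sumCongr σ τ).SameCycle (.inl a) (.inr b) := by
  rw [sameCycle_swap_mul_iff (by simp)]
  simp [ha]

/-- Two transpositions across a disjoint sum that end on different cycles of the first summand
change no relation inside the second summand. -/
theorem sameCycle_double_bridge [Finite α] [Finite β] [DecidableEq α] [DecidableEq β] {σ : Perm α}
    (τ : Perm β) {a a' : α} (b b' : β) (ha : ¬ σ.SameCycle a a') (x y : β) :
    (swap (Sum.inl a) (Sum.inr b) * (swap (Sum.inl a') (Sum.inr b') * Equiv.Perm.sumCongr σ τ)).SameCycle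
      (.inr x) (.inr y) ↔ τ.SameCycle x y := by
  have ha' : ¬ σ.SameCycle a' a := fun h => ha h.symm
  rw [sameCycle_swap_mul_iff (not_sameCycle_bridge τ b b' ha), sameCycle_bridge]
  have h : ∀ z : β, ¬ (swap (Sum.inl a') (Sum.inr b') * Equiv.Perm.sumCongr σ τ).SameCycle
      (.inr z) (.inl a) := fun z h => not_sameCycle_bridge τ z b' ha h.symm
  simp [h]

theorem numCycles_double_bridge [Finite α] [Finite β] [DecidableEq α] [DecidableEq β]
    {σ : Perm α} (τ : Perm β) {a a' : α} (b b' : β) (ha : ¬ σ.SameCycle a a') :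
    numCycles (swap (Sum.inl a) (Sum.inr b) * (swap (Sum.inl a') (Sum.inr b') * Equiv.Perm.sumCongr σ τ)) + 2 =
      numCycles σ + numCycles τ := by
  rw [← numCycles_bridge σ τ a' b', ← numCycles_swap_mul_add_one (not_sameCycle_bridge τ b b' ha)]

end Cycles

/-! ### Rotations and their local structure -/

section Rotations

variable {α β V W : Type*}

/-- A rotation of a set of darts with tail map `ν`: a permutation whose cycles are the fibres
of `ν`. -/
def IsRotation (ν : α → V) (ρ : Perm α) : Prop :=
  ∀ d e, ρ.SameCycle d e ↔ ν d = ν e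

theorem IsRotation.tail_apply {ν : α → V} {ρ : Perm α} (h : IsRotation ν ρ) (d : α) :
    ν (ρ d) = ν d :=
  ((h _ _).1 (sameCycle_apply_right.2 (.refl _ _))).symm

/-- A rotation has no proper invariant part at a vertex. -/
theorem IsRotation.induction [Finite α] {ν : α → V} {ρ : Perm α} (h : IsRotation ν ρ)
    {p : α → Prop} {d e : α} (hde : ν d = ν e) (hd : p d) (hp : ∀ z, p z → p (ρ z)) : p e :=
  SameCycle.induction ((h d e).2 hde) hd hp

theorem IsRotation.apply_ne [Finite α] {ν : α → V} {ρ : Perm α} (h : IsRotation ν ρ)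
    {d e : α} (hde : ν d = ν e) (hne : d ≠ e) : ρ d ≠ d := fun hd =>
  hne (h.induction (p := fun z => d = z) hde rfl fun z hz => by rw [← hz, hd])

theorem IsRotation.not_transposed [Finite α] {ν : α → V} {ρ : Perm α} (h : IsRotation ν ρ)
    {d d' e : α} (hde : ν d = ν e) (hne : e ≠ d) (hne' : e ≠ d') :
    ¬ (ρ d = d' ∧ ρ d' = d) := by
  rintro ⟨h1, h2⟩
  have := h.induction (p := fun z => z = d ∨ z = d') hde (.inl rfl) fun z hz => by
    rcases hz with rfl | rfl
    · exact .inr h1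
    · exact .inl h2
  tauto

theorem IsRotation.apply_of_two [Finite α] {ν : α → V} {ρ : Perm α} (h : IsRotation ν ρ)
    {a b : α} (hab : a ≠ b) (hν : ∀ d, ν d = ν a ↔ d = a ∨ d = b) : ρ a = b ∧ ρ b = a := by
  have hb : ν b = ν a := (hν b).2 (.inr rfl)
  have h1 := (hν (ρ a)).1 (h.tail_apply a)
  have h2 := (hν (ρ b)).1 ((h.tail_apply b).trans hb)
  exact ⟨h1.resolve_left (h.apply_ne hb.symm hab), h2.resolve_right (h.apply_ne hb hab.symm)⟩

theorem IsRotation.apply_of_three [Finite α] {ν : α → V} {ρ : Perm α} (h : IsRotation ν ρ)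
    {a b c : α} (hab : a ≠ b) (hac : a ≠ c) (hbc : b ≠ c)
    (hν : ∀ d, ν d = ν a ↔ d = a ∨ d = b ∨ d = c) :
    (ρ a = b ∧ ρ b = c ∧ ρ c = a) ∨ (ρ a = c ∧ ρ c = b ∧ ρ b = a) := by
  have hb : ν b = ν a := (hν b).2 (.inr (.inl rfl))
  have hc : ν c = ν a := (hν c).2 (.inr (.inr rfl))
  have h1 := (hν (ρ a)).1 (h.tail_apply a)
  have h2 := (hν (ρ b)).1 ((h.tail_apply b).trans hb)
  have h3 := (hν (ρ c)).1 ((h.tail_apply c).trans hc)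
  have n1 := h.apply_ne hb.symm hab
  have n2 := h.apply_ne hb hab.symm
  have n3 := h.apply_ne hc hac.symm
  have i1 := ρ.injective.ne hab
  have i2 := ρ.injective.ne hac
  have i3 := ρ.injective.ne hbc
  grind

theorem IsRotation.apply_of_four [Finite α] {ν : α → V} {ρ : Perm α} (h : IsRotation ν ρ)
    {a b c d : α} (hab : a ≠ b) (hac : a ≠ c) (had : a ≠ d) (hbc : b ≠ c) (hbd : b ≠ d)
    (hcd : c ≠ d) (hν : ∀ e, ν e = ν a ↔ e = a ∨ e = b ∨ e = c ∨ e = d) :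
    (ρ a = b ∧ ρ b = c ∧ ρ c = d ∧ ρ d = a) ∨ (ρ a = b ∧ ρ b = d ∧ ρ d = c ∧ ρ c = a) ∨
    (ρ a = c ∧ ρ c = b ∧ ρ b = d ∧ ρ d = a) ∨ (ρ a = c ∧ ρ c = d ∧ ρ d = b ∧ ρ b = a) ∨
    (ρ a = d ∧ ρ d = b ∧ ρ b = c ∧ ρ c = a) ∨ (ρ a = d ∧ ρ d = c ∧ ρ c = b ∧ ρ b = a) := by
  have hb : ν b = ν a := (hν b).2 (by simp)
  have hc : ν c = ν a := (hν c).2 (by simp)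
  have hd : ν d = ν a := (hν d).2 (by simp)
  have h1 := (hν (ρ a)).1 (h.tail_apply a)
  have h2 := (hν (ρ b)).1 ((h.tail_apply b).trans hb)
  have h3 := (hν (ρ c)).1 ((h.tail_apply c).trans hc)
  have h4 := (hν (ρ d)).1 ((h.tail_apply d).trans hd)
  have n1 := h.apply_ne hb.symm hab
  have n2 := h.apply_ne hb hab.symm
  have n3 := h.apply_ne hc hac.symm
  have n4 := h.apply_ne hd had.symm
  have i1 := ρ.injective.ne hab
  have i2 := ρ.injective.ne hac
  have i3 := ρ.injective.ne had
  have i4 := ρ.injective.ne hbc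
  have i5 := ρ.injective.ne hbd
  have i6 := ρ.injective.ne hcd
  have t1 := h.not_transposed (d := a) (d' := b) hc.symm hac.symm hbc.symm
  have t2 := h.not_transposed (d := a) (d' := c) hb.symm hab.symm hbc
  have t3 := h.not_transposed (d := a) (d' := d) hb.symm hab.symm hbd
  clear h hν hb hc hd
  rcases h1 with h1 | h1 | h1 | h1 <;> rcases h2 with h2 | h2 | h2 | h2 <;> grind

end Rotations

/-! ### Gluing rotations at a 2-valent vertex -/

section Gluing

variable {α β V V' W : Type*}

/-- The darts leaving the vertex `y` are `a false` and `a true`, and these are different. -/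
structure IsRootPair (ν : α → V) (y : V) (a : Bool → α) : Prop where
  ne : a false ≠ a true
  tail_eq_iff : ∀ d, ν d = y ↔ d = a false ∨ d = a true

variable {νA : α → V} {y : V} {νB : β → V'} {u : V'} {ν : α ⊕ β → W} {a : Bool → α} {b : Bool → β}

theorem IsRootPair.apply [Finite α] {ρ : Perm α} (ha : IsRootPair νA y a)
    (hρ : IsRotation νA ρ) (i : Bool) : ρ (a i) = a !i := by
  have hy : νA (a false) = y := (ha.tail_eq_iff _).2 (.inl rfl)
  have := hρ.apply_of_two ha.ne fun d => by rw [hy]; exact ha.tail_eq_iff d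
  cases i
  · exact this.1
  · exact this.2

theorem IsRootPair.tail (ha : IsRootPair νA y a) (i : Bool) : νA (a i) = y :=
  (ha.tail_eq_iff _).2 (by cases i <;> simp)

theorem IsRootPair.exists_of_tail (ha : IsRootPair νA y a) {d : α} (hd : νA d = y) :
    ∃ i, d = a i := by
  rcases (ha.tail_eq_iff d).1 hd with h | h
  exacts [⟨_, h⟩, ⟨_, h⟩]

/-- The tail map `ν` on a disjoint union of darts arises from the tail maps `νA` and `νB` when the
vertices `y` and `u` are identified. -/
structure IsGluedTail (νA : α → V) (y : V) (νB : β → V') (u : V') (ν : α ⊕ β → W) : Prop where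
  left : ∀ d e, ν (.inl d) = ν (.inl e) ↔ νA d = νA e
  right : ∀ d e, ν (.inr d) = ν (.inr e) ↔ νB d = νB e
  cross : ∀ d e, ν (.inl d) = ν (.inr e) ↔ νA d = y ∧ νB e = u

/-- The six ways to combine the rotations `(a₀ a₁)` and `(b₀ b₁)` at two 2-valent vertices into a
rotation at the merged 4-valent vertex, each given by the permutation by which
`(a₀ a₁) (b₀ b₁)` is multiplied. If the pairs do not interlace, it is a transposition `(aᵢ bⱼ)`;
for the two interlacing orders it is a 4-cycle, written as a product of three transpositions. -/
def gluing [DecidableEq α] [DecidableEq β] (a : Bool → α) (b : Bool → β) :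
    (Bool × Bool) ⊕ Bool → Perm (α ⊕ β)
  | .inl (i, j) => swap (.inl (a i)) (.inr (b j))
  | .inr j => swap (.inl (a false)) (.inr (b j)) *
      (swap (.inl (a true)) (.inr (b !j)) * swap (.inr (b false)) (.inr (b true)))

variable [DecidableEq α] [DecidableEq β]

/-- The interlacing gluings, with the third transposition on the first summand. -/
theorem gluing_inr (ha : a false ≠ a true) (hb : b false ≠ b true) (j : Bool) :
    gluing a b (.inr j) = swap (.inl (a false)) (.inr (b !j)) *
      (swap (.inl (a true)) (.inr (b j)) * swap (.inl (a false)) (.inl (a true))) := by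
  ext x
  cases j <;> rcases x with x | x <;> simp only [gluing, Perm.mul_apply, swap_apply_def] <;>
    grind

theorem gluing_apply_of_ne (c : (Bool × Bool) ⊕ Bool) {x : α ⊕ β} (ha : ∀ i, x ≠ .inl (a i))
    (hb : ∀ j, x ≠ .inr (b j)) : gluing a b c x = x := by
  rcases c with ⟨i, j⟩ | j <;>
    simp only [gluing, Perm.mul_apply, swap_apply_of_ne_of_ne, ha, hb, ne_eq, not_false_eq_true]

theorem gluing_injective (ha : a false ≠ a true) (hb : b false ≠ b true) :
    Function.Injective (gluing a b) := by
  intro c c' h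
  have h0 := congrArg (fun μ : Perm (α ⊕ β) => μ (.inl (a false))) h
  have h1 := congrArg (fun μ : Perm (α ⊕ β) => μ (.inl (a true))) h
  rcases c with ⟨_ | _, _ | _⟩ | _ | _ <;> rcases c' with ⟨_ | _, _ | _⟩ | _ | _ <;>
    first
    | rfl
    | simp [gluing, swap_apply_def, ha, hb, ha.symm, hb.symm] at h0 h1

/-- The four darts at the merged vertex form one cycle of a glued rotation. -/
theorem sameCycle_gluing_root [Finite α] [Finite β] (ha : a false ≠ a true)
    (hb : b false ≠ b true) {ρA : Perm α} {ρB : Perm β} (hρA : ∀ i, ρA (a i) = a !i)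
    (hρB : ∀ i, ρB (b i) = b !i) (c : (Bool × Bool) ⊕ Bool) (i : Bool) :
    (gluing a b c * Perm.sumCongr ρA ρB).SameCycle (.inl (a false)) (.inl (a i)) ∧
      (gluing a b c * Perm.sumCongr ρA ρB).SameCycle (.inl (a false)) (.inr (b i)) := by
  set σ := gluing a b c * Perm.sumCongr ρA ρB with hσ
  have s : ∀ x z, σ x = z → σ.SameCycle x z := fun x z h => h ▸ sameCycle_apply_right.2 (.refl _ _)
  have hA : ∀ i, σ (.inl (a i)) = gluing a b c (.inl (a !i)) := fun i => by simp [hσ, hρA]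
  have hB : ∀ i, σ (.inr (b i)) = gluing a b c (.inr (b !i)) := fun i => by simp [hσ, hρB]
  have e0 := s _ _ (hA false)
  have e1 := s _ _ (hA true)
  have e2 := s _ _ (hB false)
  have e3 := s _ _ (hB true)
  have ha' := ha.symm
  have hb' := hb.symm
  have tr := fun x y z => SameCycle.trans (f := σ) (x := x) (y := y) (z := z)
  have sy := fun x y => SameCycle.symm (f := σ) (x := x) (y := y)
  have rf := SameCycle.refl σ
  clear_value σ
  rcases c with ⟨_ | _, _ | _⟩ | _ | _ <;>
    simp [gluing, swap_apply_def, ha, hb, ha', hb'] at e0 e1 e2 e3 <;>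
    cases i <;> constructor <;> grind

theorem IsGluedTail.isRotation_gluing [Finite α] [Finite β] (hν : IsGluedTail νA y νB u ν)
    (ha : IsRootPair νA y a) (hb : IsRootPair νB u b) {ρA : Perm α} {ρB : Perm β}
    (hρA : IsRotation νA ρA) (hρB : IsRotation νB ρB) (c : (Bool × Bool) ⊕ Bool) :
    IsRotation ν (gluing a b c * Perm.sumCongr ρA ρB) := by
  have hroot := sameCycle_gluing_root ha.ne hb.ne (ha.apply hρA) (hb.apply hρB) c
  have hroot' : ∀ z z' : α ⊕ β, ((∃ i, z = .inl (a i)) ∨ ∃ i, z = .inr (b i)) →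
      ((∃ i, z' = .inl (a i)) ∨ ∃ i, z' = .inr (b i)) →
      (gluing a b c * Perm.sumCongr ρA ρB).SameCycle z z' := by
    have h0 : ∀ z : α ⊕ β, ((∃ i, z = .inl (a i)) ∨ ∃ i, z = .inr (b i)) →
        (gluing a b c * Perm.sumCongr ρA ρB).SameCycle (.inl (a false)) z := by
      rintro z (⟨i, rfl⟩ | ⟨i, rfl⟩)
      exacts [(hroot i).1, (hroot i).2]
    exact fun z z' hz hz' => (h0 z hz).symm.trans (h0 z' hz')
  have hmoved : ∀ z : α ⊕ β, gluing a b c z ≠ z → (∃ i, z = .inl (a i)) ∨ ∃ i, z = .inr (b i) := by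
    intro z hz
    by_contra! h
    exact hz (gluing_apply_of_ne c h.1 h.2)
  have hμ : ∀ z, (gluing a b c * Perm.sumCongr ρA ρB).SameCycle z (gluing a b c z) := by
    intro z
    by_cases hz : gluing a b c z = z
    · rw [hz]
    · exact hroot' _ _ (hmoved z hz) (hmoved _ fun h => hz ((gluing a b c).injective h))
  intro d e
  constructor
  · intro h
    refine SameCycle.rel (Setoid.ker ν) (fun z => ?_) h
    have h1 : ν (Perm.sumCongr ρA ρB z) = ν z := by
      rcases z with z | z
      · exact (hν.left _ _).2 (hρA.tail_apply z)
      · exact (hν.right _ _).2 (hρB.tail_apply z)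
    have h2 : ∀ z, ν (gluing a b c z) = ν z := by
      have hr : ∀ z : α ⊕ β, ((∃ i, z = .inl (a i)) ∨ ∃ i, z = .inr (b i)) →
          ν z = ν (.inl (a false)) := by
        rintro z (⟨i, rfl⟩ | ⟨i, rfl⟩)
        · exact (hν.left _ _).2 (by rw [ha.tail, ha.tail])
        · exact ((hν.cross _ _).2 ⟨ha.tail _, hb.tail _⟩).symm
      intro z
      by_cases hz : gluing a b c z = z
      · rw [hz]
      · rw [hr z (hmoved z hz), hr _ (hmoved _ fun h => hz ((gluing a b c).injective h))]
    exact (h1.symm.trans (h2 _).symm)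
  · intro h
    rcases d with d | d <;> rcases e with e | e
    · refine SameCycle.mul_left_of_forall hμ ?_
      exact (sameCycle_sumCongr_inl _ _ _ _).2 ((hρA _ _).2 ((hν.left _ _).1 h))
    · obtain ⟨h1, h2⟩ := (hν.cross _ _).1 h
      obtain ⟨i, rfl⟩ := ha.exists_of_tail h1
      obtain ⟨j, rfl⟩ := hb.exists_of_tail h2
      exact hroot' _ _ (.inl ⟨i, rfl⟩) (.inr ⟨j, rfl⟩)
    · obtain ⟨h1, h2⟩ := (hν.cross _ _).1 h.symm
      obtain ⟨i, rfl⟩ := ha.exists_of_tail h1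
      obtain ⟨j, rfl⟩ := hb.exists_of_tail h2
      exact hroot' _ _ (.inr ⟨j, rfl⟩) (.inl ⟨i, rfl⟩)
    · refine SameCycle.mul_left_of_forall hμ ?_
      exact (sameCycle_sumCongr_inr _ _ _ _).2 ((hρB _ _).2 ((hν.right _ _).1 h))

theorem gluing_mul_sumCongr_injective [Finite α] [Finite β] (ha : IsRootPair νA y a)
    (hb : IsRootPair νB u b) {ρA ρA' : Perm α} {ρB ρB' : Perm β}
    (hρA : IsRotation νA ρA) (hρA' : IsRotation νA ρA') (hρB : IsRotation νB ρB)
    (hρB' : IsRotation νB ρB') {c c' : (Bool × Bool) ⊕ Bool}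
    (h : gluing a b c * Perm.sumCongr ρA ρB = gluing a b c' * Perm.sumCongr ρA' ρB') :
    ρA = ρA' ∧ ρB = ρB' ∧ c = c' := by
  have hA : ρA = ρA' := by
    ext d
    by_cases hd : νA d = y
    · obtain ⟨i, rfl⟩ := ha.exists_of_tail hd
      rw [ha.apply hρA, ha.apply hρA']
    · have h1 := congrArg (fun μ : Perm (α ⊕ β) => μ (.inl d)) h
      have h2 : ∀ ρ : Perm α, IsRotation νA ρ → ∀ i, (Sum.inl (ρ d) : α ⊕ β) ≠ .inl (a i) := by
        intro ρ hρ i hi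
        apply hd
        rw [← hρ.tail_apply, Sum.inl_injective hi, ha.tail]
      simp only [Perm.mul_apply, Perm.sumCongr_apply, Sum.map_inl] at h1
      rw [gluing_apply_of_ne c (h2 _ hρA) (by simp),
        gluing_apply_of_ne c' (h2 _ hρA') (by simp)] at h1
      exact Sum.inl_injective h1
  have hB : ρB = ρB' := by
    ext d
    by_cases hd : νB d = u
    · obtain ⟨i, rfl⟩ := hb.exists_of_tail hd
      rw [hb.apply hρB, hb.apply hρB']
    · have h1 := congrArg (fun μ : Perm (α ⊕ β) => μ (.inr d)) h
      have h2 : ∀ ρ : Perm β, IsRotation νB ρ → ∀ i, (Sum.inr (ρ d) : α ⊕ β) ≠ .inr (b i) := by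
        intro ρ hρ i hi
        apply hd
        rw [← hρ.tail_apply, Sum.inr_injective hi, hb.tail]
      simp only [Perm.mul_apply, Perm.sumCongr_apply, Sum.map_inr] at h1
      rw [gluing_apply_of_ne c (by simp) (h2 _ hρB),
        gluing_apply_of_ne c' (by simp) (h2 _ hρB')] at h1
      exact Sum.inr_injective h1
  subst hA hB
  exact ⟨rfl, rfl, gluing_injective ha.ne hb.ne (mul_right_cancel h)⟩

/-- Every rotation at the merged vertex is one of the six gluings of two transpositions. -/
theorem IsGluedTail.exists_gluing [Finite α] [Finite β] (hν : IsGluedTail νA y νB u ν)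
    (ha : IsRootPair νA y a) (hb : IsRootPair νB u b) {ρ : Perm (α ⊕ β)}
    (hρ : IsRotation ν ρ) : ∃ c, (∀ i, ρ (.inl (a i)) = gluing a b c (.inl (a !i))) ∧
      ∀ i, ρ (.inr (b i)) = gluing a b c (.inr (b !i)) := by
  have key := hρ.apply_of_four (a := .inl (a false)) (b := .inl (a true)) (c := .inr (b false))
    (d := .inr (b true)) (by simpa using ha.ne) (by simp) (by simp) (by simp) (by simp)
    (by simpa using hb.ne) (by
      have hy := ha.tail false
      rintro (d | d)
      · rw [hν.left, hy, ha.tail_eq_iff]; simp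
      · rw [eq_comm, hν.cross, hb.tail_eq_iff]; simp [hy])
  have ha1 := ha.ne
  have hb1 := hb.ne
  have ha2 := ha.ne.symm
  have hb2 := hb.ne.symm
  rcases key with h | h | h | h | h | h
  · exact ⟨.inl (false, false), by simp [gluing, swap_apply_def, h, Bool.forall_bool, ha2, hb2]⟩
  · exact ⟨.inl (false, true), by simp [gluing, swap_apply_def, h, Bool.forall_bool, hb1, ha2]⟩
  · exact ⟨.inr true, by simp [gluing, swap_apply_def, h, Bool.forall_bool, ha1, hb1, ha2, hb2]⟩
  · exact ⟨.inl (true, false), by simp [gluing, swap_apply_def, h, Bool.forall_bool, ha1, hb2]⟩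
  · exact ⟨.inr false, by simp [gluing, swap_apply_def, h, Bool.forall_bool, ha1, hb1, ha2, hb2]⟩
  · exact ⟨.inl (true, true), by simp [gluing, swap_apply_def, h, Bool.forall_bool, ha1, hb1]⟩

theorem IsGluedTail.exists_eq_gluing_mul [Finite α] [Finite β] (hν : IsGluedTail νA y νB u ν)
    (ha : IsRootPair νA y a) (hb : IsRootPair νB u b) {ρ : Perm (α ⊕ β)}
    (hρ : IsRotation ν ρ) : ∃ ρA ρB c, IsRotation νA ρA ∧ IsRotation νB ρB ∧
      ρ = gluing a b c * Perm.sumCongr ρA ρB := by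
  obtain ⟨c, hcA, hcB⟩ := hν.exists_gluing ha hb hρ
  have hoff : ∀ z, (∀ i, z ≠ Sum.inl (a i)) → (∀ j, z ≠ .inr (b j)) →
      ((gluing a b c)⁻¹ * ρ) z = ρ z := by
    intro z hz hz'
    rw [Perm.mul_apply, Perm.inv_eq_iff_eq]
    refine (gluing_apply_of_ne c (fun i hi => ?_) fun i hi => ?_).symm
    · have h1 := hρ.tail_apply z
      rw [hi] at h1
      rcases z with z | z
      · obtain ⟨j, rfl⟩ := ha.exists_of_tail (((hν.left _ _).1 h1).symm.trans (ha.tail i))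
        exact hz j rfl
      · obtain ⟨j, rfl⟩ := hb.exists_of_tail ((hν.cross _ _).1 h1).2
        exact hz' j rfl
    · have h1 := hρ.tail_apply z
      rw [hi] at h1
      rcases z with z | z
      · obtain ⟨j, rfl⟩ := ha.exists_of_tail ((hν.cross _ _).1 h1.symm).1
        exact hz j rfl
      · obtain ⟨j, rfl⟩ := hb.exists_of_tail (((hν.right _ _).1 h1).symm.trans (hb.tail i))
        exact hz' j rfl
  have hrA : ∀ i, ((gluing a b c)⁻¹ * ρ) (.inl (a i)) = .inl (a !i) := fun i => by
    rw [Perm.mul_apply, Perm.inv_eq_iff_eq, hcA]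
  have hrB : ∀ i, ((gluing a b c)⁻¹ * ρ) (.inr (b i)) = .inr (b !i) := fun i => by
    rw [Perm.mul_apply, Perm.inv_eq_iff_eq, hcB]
  have hmaps : Set.MapsTo ((gluing a b c)⁻¹ * ρ) (Set.range Sum.inl) (Set.range Sum.inl) := by
    rintro _ ⟨d, rfl⟩
    by_cases hd : νA d = y
    · obtain ⟨i, rfl⟩ := ha.exists_of_tail hd
      exact ⟨_, (hrA i).symm⟩
    · rw [hoff _ (fun i hi => hd (by rw [Sum.inl_injective hi, ha.tail])) (by simp)]
      have h1 := hρ.tail_apply (.inl d)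
      rcases h2 : ρ (.inl d) with e | e
      · exact ⟨e, rfl⟩
      · rw [h2] at h1
        exact absurd ((hν.cross _ _).1 h1.symm).1 hd
  obtain ⟨⟨ρA, ρB⟩, hτ⟩ := mem_sumCongrHom_range_of_perm_mapsTo_inl hmaps
  replace hτ : Perm.sumCongr ρA ρB = (gluing a b c)⁻¹ * ρ := hτ
  refine ⟨ρA, ρB, c, ?_, ?_, by rw [hτ, mul_inv_cancel_left]⟩
  · have hA : ∀ d, νA d ≠ y → Sum.inl (ρA d) = ρ (.inl d) := fun d hd => by
      rw [← hoff _ (fun i hi => hd (by rw [Sum.inl_injective hi, ha.tail])) (by simp), ← hτ]; rfl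
    have hA' : ∀ i, ρA (a i) = a !i := fun i => Sum.inl_injective (β := β) <| by
      rw [← hrA, ← hτ]; rfl
    have hA'' : ∀ d, νA (ρA d) = νA d := by
      intro d
      by_cases hd : νA d = y
      · obtain ⟨i, rfl⟩ := ha.exists_of_tail hd
        rw [hA', ha.tail, ha.tail]
      · rw [← hν.left, hA d hd, hρ.tail_apply]
    intro d e
    refine ⟨fun h => SameCycle.rel (Setoid.ker νA) (fun z => (hA'' z).symm) h, fun h => ?_⟩
    by_cases hd : νA d = y
    · obtain ⟨i, rfl⟩ := ha.exists_of_tail hd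
      obtain ⟨j, rfl⟩ := ha.exists_of_tail (h ▸ hd)
      have : ρA.SameCycle (a i) (a !i) := hA' i ▸ sameCycle_apply_right.2 (.refl _ _)
      cases i <;> cases j <;> first | exact .refl _ _ | exact this
    · have h1 := (hρ _ _).2 ((hν.left _ _).2 h)
      rw [← sameCycle_sumCongr_inl ρA ρB]
      refine SameCycle.congr_on (p := fun z => ν z = ν (.inl d)) (fun z hz => ?_) rfl h1
      refine ⟨(hρ.tail_apply z).trans hz, ?_⟩
      rw [hτ, hoff]
      · rintro i rfl
        exact hd (((hν.left _ _).1 hz).symm.trans (ha.tail i))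
      · rintro i rfl
        exact hd ((hν.cross _ _).1 hz.symm).1
  · have hB : ∀ d, νB d ≠ u → Sum.inr (ρB d) = ρ (.inr d) := fun d hd => by
      rw [← hoff _ (by simp) (fun i hi => hd (by rw [Sum.inr_injective hi, hb.tail])), ← hτ]; rfl
    have hB' : ∀ i, ρB (b i) = b !i := fun i => Sum.inr_injective (α := α) <| by
      rw [← hrB, ← hτ]; rfl
    have hB'' : ∀ d, νB (ρB d) = νB d := by
      intro d
      by_cases hd : νB d = u
      · obtain ⟨i, rfl⟩ := hb.exists_of_tail hd
        rw [hB', hb.tail, hb.tail]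
      · rw [← hν.right, hB d hd, hρ.tail_apply]
    intro d e
    refine ⟨fun h => SameCycle.rel (Setoid.ker νB) (fun z => (hB'' z).symm) h, fun h => ?_⟩
    by_cases hd : νB d = u
    · obtain ⟨i, rfl⟩ := hb.exists_of_tail hd
      obtain ⟨j, rfl⟩ := hb.exists_of_tail (h ▸ hd)
      have : ρB.SameCycle (b i) (b !i) := hB' i ▸ sameCycle_apply_right.2 (.refl _ _)
      cases i <;> cases j <;> first | exact .refl _ _ | exact this
    · have h1 := (hρ _ _).2 ((hν.right _ _).2 h)
      rw [← sameCycle_sumCongr_inr ρA ρB]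
      refine SameCycle.congr_on (p := fun z => ν z = ν (.inr d)) (fun z hz => ?_) rfl h1
      refine ⟨(hρ.tail_apply z).trans hz, ?_⟩
      rw [hτ, hoff]
      · rintro i rfl
        exact hd ((hν.cross _ _).1 hz).2
      · rintro i rfl
        exact hd (((hν.right _ _).1 hz).symm.trans (hb.tail i))

end Gluing

/-! ### Faces of a glued rotation -/

section GluedFaces

variable {α β : Type*} [DecidableEq α] [DecidableEq β] {a : Bool → α} {b : Bool → β}

theorem gluing_inr_mul (φ : Perm α) (ψ : Perm β) (j : Bool) :
    gluing a b (.inr j) * Perm.sumCongr φ ψ = swap (.inl (a false)) (.inr (b j)) *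
      (swap (.inl (a true)) (.inr (b !j)) *
        Perm.sumCongr φ (swap (b false) (b true) * ψ)) := by
  have : swap (.inr (b false)) (.inr (b true)) * Perm.sumCongr φ ψ =
      Perm.sumCongr φ (swap (b false) (b true) * ψ) := by
    rw [← Perm.sumCongr_one_swap, Perm.sumCongr_mul, one_mul]
  rw [← this]
  simp only [gluing, mul_assoc]

theorem gluing_inr_mul' (ha : a false ≠ a true) (hb : b false ≠ b true) (φ : Perm α)
    (ψ : Perm β) (j : Bool) :
    gluing a b (.inr j) * Perm.sumCongr φ ψ = swap (.inl (a false)) (.inr (b !j)) *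
      (swap (.inl (a true)) (.inr (b j)) *
        Perm.sumCongr (swap (a false) (a true) * φ) ψ) := by
  have : swap (.inl (a false)) (.inl (a true)) * Perm.sumCongr φ ψ =
      Perm.sumCongr (swap (a false) (a true) * φ) ψ := by
    rw [← Perm.sumCongr_swap_one, Perm.sumCongr_mul, one_mul]
  rw [← this, gluing_inr ha hb]
  simp only [mul_assoc]

variable [Finite α] [Finite β]

theorem numCycles_gluing_inl (φ : Perm α) (ψ : Perm β) (c : Bool × Bool) :
    numCycles (gluing a b (.inl c) * Perm.sumCongr φ ψ) + 1 = numCycles φ + numCycles ψ :=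
  numCycles_bridge _ _ _ _

theorem sameCycle_gluing_inl (φ : Perm α) (ψ : Perm β) (c : Bool × Bool) (x z : β) :
    (gluing a b (.inl c) * Perm.sumCongr φ ψ).SameCycle (.inr x) (.inr z) ↔ ψ.SameCycle x z :=
  sameCycle_bridge _ _ _ _ _ _

/-- If the first root lies on two faces, an interlacing gluing acts on the second summand like the
transposition of the two darts at its root. -/
theorem numCycles_gluing_inr_of_not {φ : Perm α} (ψ : Perm β)
    (h : ¬ φ.SameCycle (a false) (a true)) (j : Bool) :
    numCycles (gluing a b (.inr j) * Perm.sumCongr φ ψ) + 2 =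
      numCycles φ + numCycles (swap (b false) (b true) * ψ) := by
  rw [gluing_inr_mul, numCycles_double_bridge _ _ _ h]

theorem sameCycle_gluing_inr_of_not {φ : Perm α} (ψ : Perm β)
    (h : ¬ φ.SameCycle (a false) (a true)) (j : Bool) (x z : β) :
    (gluing a b (.inr j) * Perm.sumCongr φ ψ).SameCycle (.inr x) (.inr z) ↔
      (swap (b false) (b true) * ψ).SameCycle x z := by
  rw [gluing_inr_mul, sameCycle_double_bridge _ _ _ h]

/-- If the first root lies on one face only, an interlacing gluing first splits this face, and then
joins the two parts to faces of the second summand. -/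
theorem numCycles_gluing_inr_of_sameCycle (ha : a false ≠ a true) (hb : b false ≠ b true)
    {φ : Perm α} (ψ : Perm β) (h : φ.SameCycle (a false) (a true)) (j : Bool) :
    numCycles (gluing a b (.inr j) * Perm.sumCongr φ ψ) + 1 = numCycles φ + numCycles ψ := by
  have h1 := numCycles_double_bridge ψ (b !j) (b j) (not_sameCycle_swap_mul ha h)
  rw [numCycles_swap_mul_of_sameCycle ha h] at h1
  rw [gluing_inr_mul' ha hb]
  omega

theorem sameCycle_gluing_inr_of_sameCycle (ha : a false ≠ a true) (hb : b false ≠ b true)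
    {φ : Perm α} (ψ : Perm β) (h : φ.SameCycle (a false) (a true)) (j : Bool) (x z : β) :
    (gluing a b (.inr j) * Perm.sumCongr φ ψ).SameCycle (.inr x) (.inr z) ↔ ψ.SameCycle x z := by
  rw [gluing_inr_mul' ha hb, sameCycle_double_bridge _ _ _ (not_sameCycle_swap_mul ha h)]

end GluedFaces

/-! ### Darts of an amalgamation -/

section AmalgamDarts

/-- The reversal of darts. -/
def dartRev {V : Type*} (G : SimpleGraph V) : Perm G.Dart :=
  Function.Involutive.toPerm SimpleGraph.Dart.symm SimpleGraph.Dart.symm_involutive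

theorem nat_card_dart {V : Type*} [Finite V] (G : SimpleGraph V) :
    Nat.card G.Dart = 2 * Nat.card G.edgeSet := by
  classical
  have := Fintype.ofFinite V
  rw [Nat.card_eq_fintype_card, G.dart_card_eq_twice_card_edges, Nat.card_eq_fintype_card,
    ← SimpleGraph.edgeFinset_card]

variable (X : RootedGraph) (H : DoublyRootedGraph)

theorem amalgamRight_ne (w : H.V) (hw : w ≠ H.fstRoot) :
    amalgamRight X H w = .inr ⟨w, hw⟩ :=
  dif_neg hw

theorem amalgamRight_fstRoot : amalgamRight X H H.fstRoot = .inl X.root :=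
  dif_pos rfl

theorem amalgamLeft_eq_amalgamRight_iff (x : X.V) (w : H.V) :
    amalgamLeft X H x = amalgamRight X H w ↔ x = X.root ∧ w = H.fstRoot := by
  by_cases hw : w = H.fstRoot
  · subst hw
    rw [amalgamRight_fstRoot]
    simp [amalgamLeft]
  · rw [amalgamRight_ne X H w hw]
    simp [amalgamLeft, hw]

/-- The darts of the amalgamation are those of the two graphs. -/
noncomputable def amalgamDart :
    X.graph.Dart ⊕ H.graph.Dart ≃ (amalgamate X H).graph.Dart :=
  Equiv.ofBijective
    (Sum.elim
      (fun d => ⟨(amalgamLeft X H d.fst, amalgamLeft X H d.snd),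
        Or.inl ((SimpleGraph.map_adj_apply).2 d.adj)⟩)
      (fun d => ⟨(amalgamRight X H d.fst, amalgamRight X H d.snd),
        Or.inr ((SimpleGraph.map_adj_apply).2 d.adj)⟩)) <| by
    constructor
    · rintro (d | d) (e | e) h <;>
      have h1 := congrArg (fun d => d.toProd.1) h <;>
      have h2 := congrArg (fun d => d.toProd.2) h <;>
      simp only [Sum.elim_inl, Sum.elim_inr] at h1 h2
      · exact congrArg _ (SimpleGraph.Dart.ext _ _ (Prod.ext ((amalgamLeft X H).injective h1)
          ((amalgamLeft X H).injective h2)))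
      · exact absurd (((amalgamLeft_eq_amalgamRight_iff X H _ _).1 h1).1.trans
          ((amalgamLeft_eq_amalgamRight_iff X H _ _).1 h2).1.symm) d.fst_ne_snd
      · exact absurd (((amalgamLeft_eq_amalgamRight_iff X H _ _).1 h1.symm).1.trans
          ((amalgamLeft_eq_amalgamRight_iff X H _ _).1 h2.symm).1.symm) e.fst_ne_snd
      · exact congrArg _ (SimpleGraph.Dart.ext _ _ (Prod.ext ((amalgamRight X H).injective h1)
          ((amalgamRight X H).injective h2)))
    · rintro ⟨⟨v, w⟩, h | h⟩
      · obtain ⟨v', w', h', rfl, rfl⟩ := (SimpleGraph.map_adj _ _ _ _).1 h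
        exact ⟨.inl ⟨(v', w'), h'⟩, rfl⟩
      · obtain ⟨v', w', h', rfl, rfl⟩ := (SimpleGraph.map_adj _ _ _ _).1 h
        exact ⟨.inr ⟨(v', w'), h'⟩, rfl⟩

/-- The tail of a dart of the amalgamation. -/
noncomputable def amalgamTail (d : X.graph.Dart ⊕ H.graph.Dart) : AmalgamVertex X H :=
  (amalgamDart X H d).fst

theorem isGluedTail_amalgamTail :
    IsGluedTail (fun d : X.graph.Dart => d.fst) X.root (fun d : H.graph.Dart => d.fst) H.fstRoot
      (amalgamTail X H) where
  left _ _ := (amalgamLeft X H).apply_eq_iff_eq _ _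
  right _ _ := (amalgamRight X H).apply_eq_iff_eq _ _
  cross _ _ := amalgamLeft_eq_amalgamRight_iff X H _ _

theorem isRotationSystem_permCongr_amalgamDart (ρ : Perm (X.graph.Dart ⊕ H.graph.Dart)) :
    IsRotationSystem (amalgamate X H).graph ((amalgamDart X H).permCongr ρ) ↔
      IsRotation (amalgamTail X H) ρ := by
  constructor
  · intro h d e
    have := h (amalgamDart X H d) (amalgamDart X H e)
    rwa [sameCycle_permCongr, symm_apply_apply, symm_apply_apply] at this
  · intro h d e
    rw [sameCycle_permCongr, h]
    simp only [amalgamTail, apply_symm_apply]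
    exact Iff.rfl

theorem facePerm_permCongr_amalgamDart (μ : Perm (X.graph.Dart ⊕ H.graph.Dart))
    (ρ : Perm X.graph.Dart) (σ : Perm H.graph.Dart) :
    facePerm ((amalgamDart X H).permCongr (μ * Perm.sumCongr ρ σ)) =
      (amalgamDart X H).permCongr (μ * Perm.sumCongr (facePerm ρ) (facePerm σ)) := by
  have hrev : dartRev (amalgamate X H).graph = (amalgamDart X H).permCongr
      (Perm.sumCongr (dartRev X.graph) (dartRev H.graph)) := by
    ext1 d
    obtain ⟨d, rfl⟩ := (amalgamDart X H).surjective d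
    rw [Equiv.permCongr_apply, symm_apply_apply]
    rcases d with d | d <;> rfl
  change _ * dartRev _ = (amalgamDart X H).permCongrHom
    (μ * Perm.sumCongr (ρ * dartRev X.graph) (σ * dartRev H.graph))
  rw [hrev, ← Perm.sumCongr_mul, ← mul_assoc, map_mul (amalgamDart X H).permCongrHom]
  rfl

theorem nat_card_amalgamVertex :
    Nat.card (AmalgamVertex X H) + 1 = Nat.card X.V + Nat.card H.V := by
  classical
  have := X.finite
  have := H.finite
  have h := Nat.card_congr (Equiv.sumCompl (fun w : H.V => w = H.fstRoot))
  rw [Nat.card_sum, Nat.card_unique] at h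
  rw [Nat.card_sum, ← h]
  change _ + Nat.card {w : H.V // ¬ w = H.fstRoot} + 1 = _
  omega

theorem nat_card_edgeSet_amalgamate : Nat.card (amalgamate X H).graph.edgeSet =
    Nat.card X.graph.edgeSet + Nat.card H.graph.edgeSet := by
  have := X.finite
  have := H.finite
  have := (amalgamate X H).finite
  have h := Nat.card_congr (amalgamDart X H)
  have hX : Finite X.graph.Dart := Finite.of_injective _ SimpleGraph.Dart.toProd_injective
  have hH : Finite H.graph.Dart := Finite.of_injective _ SimpleGraph.Dart.toProd_injective
  rw [Nat.card_sum, nat_card_dart, nat_card_dart, nat_card_dart] at h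
  omega

/-- The darts at the new root. -/
theorem isRootPair_amalgamate {e : Bool → H.graph.Dart}
    (he : IsRootPair (fun d : H.graph.Dart => d.fst) H.sndRoot e) :
    IsRootPair (fun d : (amalgamate X H).graph.Dart => d.fst) (amalgamate X H).root
      (fun i => amalgamDart X H (.inr (e i))) where
  ne h := he.ne (Sum.inr_injective ((amalgamDart X H).injective h))
  tail_eq_iff d := by
    obtain ⟨d, rfl⟩ := (amalgamDart X H).surjective d
    rw [(amalgamDart X H).apply_eq_iff_eq, (amalgamDart X H).apply_eq_iff_eq]
    have hroot : (amalgamate X H).root = amalgamRight X H H.sndRoot :=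
      (amalgamRight_ne X H _ H.ne).symm
    rw [hroot]
    rcases d with d | d
    · refine iff_of_false (fun h => H.ne ?_) (by simp)
      exact ((amalgamLeft_eq_amalgamRight_iff X H _ _).1 h).2
    · rw [Sum.inr_injective.eq_iff, Sum.inr_injective.eq_iff, ← he.tail_eq_iff]
      exact (amalgamRight X H).apply_eq_iff_eq _ _

end AmalgamDarts

/-! ### Partial genus distributions of an amalgamation -/

section Counting

variable {V : Type*} (G : SimpleGraph V)

/-- The partial genus distributions in uniform notation: `t` records whether two different faces
are incident on the root. -/
noncomputable def partialCount (y : V) (t : Bool) (i : ℕ) : ℕ :=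
  Nat.card {ρ : {ρ : Perm G.Dart // IsRotationSystem G ρ} //
    HasGenus ρ.1 i ∧ (RootOnTwoFaces ρ.1 y ↔ t = true)}

variable {G}

theorem rootOnOneFace_iff (ρ : Perm G.Dart) (y : V) :
    RootOnOneFace ρ y ↔ ¬ RootOnTwoFaces ρ y := by
  simp only [RootOnOneFace, RootOnTwoFaces]
  push Not
  rfl

theorem rootOnTwoFaces_iff {y : V} {a : Bool → G.Dart}
    (ha : IsRootPair (fun d : G.Dart => d.fst) y a) (ρ : Perm G.Dart) :
    RootOnTwoFaces ρ y ↔ ¬ (facePerm ρ).SameCycle (a false) (a true) := by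
  constructor
  · rintro ⟨d, e, hd, he, hde⟩ h
    obtain ⟨i, rfl⟩ := ha.exists_of_tail hd
    obtain ⟨j, rfl⟩ := ha.exists_of_tail he
    cases i <;> cases j
    exacts [hde (.refl _ _), hde h, hde h.symm, hde (.refl _ _)]
  · exact fun h => ⟨_, _, ha.tail _, ha.tail _, h⟩

theorem HasGenus.unique {ρ : Perm G.Dart} {i j : ℕ} (hi : HasGenus ρ i) (hj : HasGenus ρ j) :
    i = j := by
  unfold HasGenus at *
  omega

variable (G)

theorem partialD_eq (y : V) : partialD G y = partialCount G y true := by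
  funext i
  refine (Nat.card_congr ((Equiv.subtypeSubtypeEquivSubtypeInter _
    (fun ρ : Perm G.Dart => HasGenus ρ i ∧ (RootOnTwoFaces ρ y ↔ true = true))).trans
    (Equiv.subtypeEquivRight fun ρ => ?_))).symm
  simp

theorem partialS_eq (y : V) : partialS G y = partialCount G y false := by
  funext i
  refine (Nat.card_congr ((Equiv.subtypeSubtypeEquivSubtypeInter _
    (fun ρ : Perm G.Dart => HasGenus ρ i ∧ (RootOnTwoFaces ρ y ↔ false = true))).trans
    (Equiv.subtypeEquivRight fun ρ => ?_))).symm
  simp [rootOnOneFace_iff]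

theorem finite_rotationSystem [Finite V] : Finite {ρ : Perm G.Dart // IsRotationSystem G ρ} := by
  have : Finite G.Dart := Finite.of_injective _ SimpleGraph.Dart.toProd_injective
  infer_instance

theorem nat_card_subtype_add_not {α : Type*} [Finite α] (p q : α → Prop) :
    Nat.card {x // p x} = Nat.card {x // p x ∧ q x} + Nat.card {x // p x ∧ ¬ q x} := by
  classical
  rw [← Nat.card_congr (Equiv.sumCompl fun x : {x // p x} => q x), Nat.card_sum,
    Nat.card_congr (Equiv.subtypeSubtypeEquivSubtypeInter p q),
    Nat.card_congr (Equiv.subtypeSubtypeEquivSubtypeInter p fun x => ¬ q x)]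

theorem genusDistribution_eq [Finite V] (y : V) :
    genusDistribution G = fun i => partialD G y i + partialS G y i := by
  funext i
  have := finite_rotationSystem G
  rw [partialD_eq, partialS_eq, genusDistribution, partialCount, partialCount,
    ← Nat.card_congr (Equiv.subtypeSubtypeEquivSubtypeInter _ (fun ρ : Perm G.Dart => HasGenus ρ i)),
    nat_card_subtype_add_not _ (fun ρ => RootOnTwoFaces ρ.1 y)]
  simp

end Counting

/-- The sequence `a`, shifted by `j` places to the right; the coefficients of `xʲ a(x)`. -/
def shift (j : ℕ) (a : ℕ → ℕ) (k : ℕ) : ℕ := if j ≤ k then a (k - j) else 0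

section Recursion

variable {V : Type*} {G : SimpleGraph V}

theorem nat_card_shift {R : Type*} (g : R → ℕ → Prop) (B : R → Prop) (j k : ℕ) :
    Nat.card {ρ : R // (∃ i, g ρ i ∧ k = i + j) ∧ B ρ} =
      shift j (fun i => Nat.card {ρ : R // g ρ i ∧ B ρ}) k := by
  unfold shift
  split_ifs with h
  · refine Nat.card_congr (Equiv.subtypeEquivRight fun ρ => and_congr_left fun _ => ?_)
    constructor
    · rintro ⟨i, hi, rfl⟩
      simpa using hi
    · exact fun hi => ⟨_, hi, by omega⟩
  · have : IsEmpty {ρ : R // (∃ i, g ρ i ∧ k = i + j) ∧ B ρ} :=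
      ⟨fun ⟨ρ, ⟨i, _, hk⟩, _⟩ => by omega⟩
    exact Nat.card_of_isEmpty

theorem nat_card_and_const {R : Type*} (p : R → Prop) (q : Prop) [Decidable q] :
    Nat.card {ρ : R // p ρ ∧ q} = if q then Nat.card {ρ : R // p ρ} else 0 := by
  split_ifs with h <;> simp [h]

variable (X : RootedGraph) (H : DoublyRootedGraph)

/-- The rotation system of the amalgamation given by rotation systems of the two graphs and a
gluing of the rotations at the two roots. -/
noncomputable def amalgamRotation [DecidableEq X.graph.Dart] [DecidableEq H.graph.Dart]
    (a : Bool → X.graph.Dart) (b : Bool → H.graph.Dart) (c : (Bool × Bool) ⊕ Bool)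
    (ρ : Perm X.graph.Dart) (σ : Perm H.graph.Dart) : Perm (amalgamate X H).graph.Dart :=
  (amalgamDart X H).permCongr (gluing a b c * Perm.sumCongr ρ σ)

variable {X H}

theorem hasGenus_of_numFaces {ρ : Perm (amalgamate X H).graph.Dart} {f j i k : ℕ}
    {ρ' : Perm X.graph.Dart} (hf : numFaces ρ + 1 = numFaces ρ' + f)
    (hj : Nat.card H.V + f + 2 * j = Nat.card H.graph.edgeSet + 2) (hi : HasGenus ρ' i) :
    HasGenus ρ k ↔ k = i + j := by
  have hV : Nat.card (amalgamate X H).V + 1 = _ := nat_card_amalgamVertex X H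
  have hE := nat_card_edgeSet_amalgamate X H
  unfold HasGenus at *
  omega

variable [DecidableEq X.graph.Dart] [DecidableEq H.graph.Dart]
    {a : Bool → X.graph.Dart} {b e : Bool → H.graph.Dart}

theorem RootedGraph.finite_dart (X : RootedGraph) : Finite X.graph.Dart :=
  have := X.finite
  Finite.of_injective _ SimpleGraph.Dart.toProd_injective

theorem DoublyRootedGraph.finite_dart (H : DoublyRootedGraph) : Finite H.graph.Dart :=
  have := H.finite
  Finite.of_injective _ SimpleGraph.Dart.toProd_injective

theorem isRotationSystem_amalgamRotation
    (ha : IsRootPair (fun d : X.graph.Dart => d.fst) X.root a)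
    (hb : IsRootPair (fun d : H.graph.Dart => d.fst) H.fstRoot b) {ρ : Perm X.graph.Dart}
    {σ : Perm H.graph.Dart} (hρ : IsRotationSystem X.graph ρ) (hσ : IsRotationSystem H.graph σ)
    (c : (Bool × Bool) ⊕ Bool) :
    IsRotationSystem (amalgamate X H).graph (amalgamRotation X H a b c ρ σ) :=
  have := X.finite_dart
  have := H.finite_dart
  (isRotationSystem_permCongr_amalgamDart X H _).2
    ((isGluedTail_amalgamTail X H).isRotation_gluing ha hb hρ hσ c)

/-- Every rotation system of an amalgamation comes from unique rotation systems of the two graphs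
and a unique gluing. -/
theorem amalgamRotation_bijective
    (ha : IsRootPair (fun d : X.graph.Dart => d.fst) X.root a)
    (hb : IsRootPair (fun d : H.graph.Dart => d.fst) H.fstRoot b) : Function.Bijective
    fun t : (((Bool × Bool) ⊕ Bool) × {σ : Perm H.graph.Dart // IsRotationSystem H.graph σ}) ×
        {ρ : Perm X.graph.Dart // IsRotationSystem X.graph ρ} =>
      (⟨amalgamRotation X H a b t.1.1 t.2.1 t.1.2.1,
        isRotationSystem_amalgamRotation ha hb t.2.2 t.1.2.2 t.1.1⟩ :
        {ρ : Perm (amalgamate X H).graph.Dart // IsRotationSystem (amalgamate X H).graph ρ}) := by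
  have := X.finite_dart
  have := H.finite_dart
  constructor
  · rintro ⟨⟨c, σ, hσ⟩, ρ, hρ⟩ ⟨⟨c', σ', hσ'⟩, ρ', hρ'⟩ h
    have h' := (amalgamDart X H).permCongr.injective (congrArg Subtype.val h)
    obtain ⟨rfl, rfl, rfl⟩ := gluing_mul_sumCongr_injective ha hb hρ hρ' hσ hσ' h'
    rfl
  · rintro ⟨ρ, hρ⟩
    obtain ⟨ρ, rfl⟩ := (amalgamDart X H).permCongr.surjective ρ
    obtain ⟨ρA, ρB, c, hA, hB, rfl⟩ := (isGluedTail_amalgamTail X H).exists_eq_gluing_mul ha hb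
      ((isRotationSystem_permCongr_amalgamDart X H _).1 hρ)
    exact ⟨⟨⟨c, ρB, hB⟩, ρA, hA⟩, rfl⟩

theorem numFaces_amalgamRotation (c : (Bool × Bool) ⊕ Bool) (ρ : Perm X.graph.Dart)
    (σ : Perm H.graph.Dart) : numFaces (amalgamRotation X H a b c ρ σ) =
      numCycles (gluing a b c * Perm.sumCongr (facePerm ρ) (facePerm σ)) := by
  change numCycles (facePerm _) = _
  rw [amalgamRotation, facePerm_permCongr_amalgamDart, numCycles_permCongr]

theorem rootOnTwoFaces_amalgamRotation
    (he : IsRootPair (fun d : H.graph.Dart => d.fst) H.sndRoot e) (c : (Bool × Bool) ⊕ Bool)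
    (ρ : Perm X.graph.Dart) (σ : Perm H.graph.Dart) :
    RootOnTwoFaces (amalgamRotation X H a b c ρ σ) (amalgamate X H).root ↔
      ¬ (gluing a b c * Perm.sumCongr (facePerm ρ) (facePerm σ)).SameCycle
        (.inr (e false)) (.inr (e true)) := by
  rw [rootOnTwoFaces_iff (isRootPair_amalgamate X H he), amalgamRotation,
    facePerm_permCongr_amalgamDart, sameCycle_permCongr, symm_apply_apply, symm_apply_apply]

/-- What has to be known about the rotation systems of a doubly rooted graph, with darts
`b false`, `b true` at the first and `e false`, `e true` at the second root: an enumeration, the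
genus, whether the second root lies on two faces, and the same data for the face permutation
multiplied by the transposition of the two darts at the first root. The twisted genus counts the
handles that an interlacing gluing adds to a graph whose root lies on two faces. -/
structure TransferData (H : DoublyRootedGraph) [DecidableEq H.graph.Dart]
    (b e : Bool → H.graph.Dart) (P : Type*) where
  rotation : P ≃ {σ : Perm H.graph.Dart // IsRotationSystem H.graph σ}
  genus : P → ℕ
  hasGenus : ∀ p, HasGenus (rotation p).1 (genus p)
  twoFaces : P → Bool
  twoFaces_iff : ∀ p,
    ¬ (facePerm (rotation p).1).SameCycle (e false) (e true) ↔ twoFaces p = true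
  twistedGenus : P → ℕ
  hasTwistedGenus : ∀ p, Nat.card H.V +
    numCycles (swap (b false) (b true) * facePerm (rotation p).1) + 2 * twistedGenus p =
      Nat.card H.graph.edgeSet + 3
  twistedTwoFaces : P → Bool
  twistedTwoFaces_iff : ∀ p,
    ¬ (swap (b false) (b true) * facePerm (rotation p).1).SameCycle (e false) (e true) ↔
      twistedTwoFaces p = true

variable {P : Type*} (T : TransferData H b e P)

/-- Genus and root type of an embedding of the amalgamation, unless the gluing is interlacing and
the root of the first graph lies on two faces. -/
theorem TransferData.amalgamRotation_spec
    (ha : IsRootPair (fun d : X.graph.Dart => d.fst) X.root a)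
    (hb : IsRootPair (fun d : H.graph.Dart => d.fst) H.fstRoot b)
    (he : IsRootPair (fun d : H.graph.Dart => d.fst) H.sndRoot e)
    {c : (Bool × Bool) ⊕ Bool} {ρ : Perm X.graph.Dart} {i : ℕ} (hi : HasGenus ρ i) (p : P)
    (hc : (∃ c', c = .inl c') ∨ ¬ RootOnTwoFaces ρ X.root) :
    (∀ k, HasGenus (amalgamRotation X H a b c ρ (T.rotation p).1) k ↔ k = i + T.genus p) ∧
      (RootOnTwoFaces (amalgamRotation X H a b c ρ (T.rotation p).1) (amalgamate X H).root ↔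
        T.twoFaces p = true) := by
  have := X.finite_dart
  have := H.finite_dart
  rw [rootOnTwoFaces_amalgamRotation he, ← T.twoFaces_iff]
  rcases c with c | j
  · refine ⟨fun k => hasGenus_of_numFaces ?_ (T.hasGenus p) hi, ?_⟩
    · rw [numFaces_amalgamRotation]
      exact numCycles_gluing_inl _ _ _
    · rw [sameCycle_gluing_inl]
  · have h := hc.resolve_left (by simp)
    rw [rootOnTwoFaces_iff ha, not_not] at h
    refine ⟨fun k => hasGenus_of_numFaces ?_ (T.hasGenus p) hi, ?_⟩
    · rw [numFaces_amalgamRotation]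
      exact numCycles_gluing_inr_of_sameCycle ha.ne hb.ne _ h _
    · rw [sameCycle_gluing_inr_of_sameCycle ha.ne hb.ne _ h]

/-- Genus and root type of an embedding of the amalgamation, if the gluing is interlacing and
the root of the first graph lies on two faces. -/
theorem TransferData.amalgamRotation_spec_twisted
    (ha : IsRootPair (fun d : X.graph.Dart => d.fst) X.root a)
    (he : IsRootPair (fun d : H.graph.Dart => d.fst) H.sndRoot e)
    {ρ : Perm X.graph.Dart} {i : ℕ} (hi : HasGenus ρ i) (p : P) (j : Bool)
    (h : RootOnTwoFaces ρ X.root) :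
    (∀ k, HasGenus (amalgamRotation X H a b (.inr j) ρ (T.rotation p).1) k ↔
        k = i + T.twistedGenus p) ∧
      (RootOnTwoFaces (amalgamRotation X H a b (.inr j) ρ (T.rotation p).1)
        (amalgamate X H).root ↔ T.twistedTwoFaces p = true) := by
  have := X.finite_dart
  have := H.finite_dart
  rw [rootOnTwoFaces_iff ha] at h
  rw [rootOnTwoFaces_amalgamRotation he, ← T.twistedTwoFaces_iff, sameCycle_gluing_inr_of_not _ h]
  refine ⟨fun k => ?_, Iff.rfl⟩
  have h1 := numCycles_gluing_inr_of_not (b := b) (facePerm (T.rotation p).1) h j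
  have h2 := T.hasTwistedGenus p
  rw [← numFaces_amalgamRotation] at h1
  have hV : Nat.card (amalgamate X H).V + 1 = _ := nat_card_amalgamVertex X H
  have hE := nat_card_edgeSet_amalgamate X H
  change _ + 2 = numFaces ρ + _ at h1
  unfold HasGenus at *
  omega

theorem TransferData.exists_hasGenus_amalgamate (T : TransferData H b e P)
    (ha : IsRootPair (fun d : X.graph.Dart => d.fst) X.root a)
    (hb : IsRootPair (fun d : H.graph.Dart => d.fst) H.fstRoot b)
    (he : IsRootPair (fun d : H.graph.Dart => d.fst) H.sndRoot e)
    (hX : ∀ ρ, IsRotationSystem X.graph ρ → ∃ i, HasGenus ρ i)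
    (ρ : Perm (amalgamate X H).graph.Dart) (hρ : IsRotationSystem (amalgamate X H).graph ρ) :
    ∃ i, HasGenus ρ i := by
  obtain ⟨⟨⟨c, σ⟩, ρX⟩, h⟩ := (amalgamRotation_bijective ha hb).2 ⟨ρ, hρ⟩
  obtain ⟨p, rfl⟩ := T.rotation.surjective σ
  obtain ⟨i, hi⟩ := hX ρX.1 ρX.2
  have h' := congrArg Subtype.val h
  simp only at h'
  subst h'
  by_cases hc : (∃ c', c = .inl c') ∨ ¬ RootOnTwoFaces ρX.1 X.root
  · exact ⟨_, ((T.amalgamRotation_spec ha hb he hi p hc).1 _).2 rfl⟩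
  · push Not at hc
    rcases c with c | j
    · exact absurd rfl (hc.1 c)
    · exact ⟨_, ((T.amalgamRotation_spec_twisted ha he hi p j hc.2).1 _).2 rfl⟩

/-- The partial genus distributions of an amalgamation. The four gluings that do not interlace and
the two that do contribute the coefficients 4 and 2. -/
theorem TransferData.partialCount_amalgamate [Fintype P]
    (ha : IsRootPair (fun d : X.graph.Dart => d.fst) X.root a)
    (hb : IsRootPair (fun d : H.graph.Dart => d.fst) H.fstRoot b)
    (he : IsRootPair (fun d : H.graph.Dart => d.fst) H.sndRoot e)
    (hX : ∀ ρ, IsRotationSystem X.graph ρ → ∃ i, HasGenus ρ i) (t : Bool) (k : ℕ) :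
    partialCount (amalgamate X H).graph (amalgamate X H).root t k =
      ∑ p, ((if T.twoFaces p = t then
          4 * shift (T.genus p) (partialCount X.graph X.root true) k +
          6 * shift (T.genus p) (partialCount X.graph X.root false) k else 0) +
        if T.twistedTwoFaces p = t then
          2 * shift (T.twistedGenus p) (partialCount X.graph X.root true) k else 0) := by
  have := X.finite
  have hfin := finite_rotationSystem X.graph
  -- The embeddings of `X` that give an embedding of the wanted kind, for a fixed gluing `c` and a
  -- fixed rotation system of `H`, split according to the type of the root of `X`.
  let Q : ((Bool × Bool) ⊕ Bool) × P → {ρ : Perm X.graph.Dart // IsRotationSystem X.graph ρ} →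
      Prop := fun q ρ => HasGenus (amalgamRotation X H a b q.1 ρ.1 (T.rotation q.2).1) k ∧
        (RootOnTwoFaces (amalgamRotation X H a b q.1 ρ.1 (T.rotation q.2).1)
          (amalgamate X H).root ↔ t = true)
  have hplain : ∀ (q : ((Bool × Bool) ⊕ Bool) × P) (s : Bool),
      ((∃ c', q.1 = .inl c') ∨ s = false) →
      Nat.card {ρ // Q q ρ ∧ (RootOnTwoFaces ρ.1 X.root ↔ s = true)} =
        if T.twoFaces q.2 = t then
          shift (T.genus q.2) (partialCount X.graph X.root s) k else 0 := by
    intro q s hs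
    unfold partialCount
    rw [← nat_card_shift
      (fun (ρ : {ρ : Perm X.graph.Dart // IsRotationSystem X.graph ρ}) i => HasGenus ρ.1 i), ← nat_card_and_const]
    refine Nat.card_congr (Equiv.subtypeEquivRight fun ρ => ?_)
    obtain ⟨i, hi⟩ := hX ρ.1 ρ.2
    have hg : (∃ i, HasGenus ρ.1 i ∧ k = i + T.genus q.2) ↔ k = i + T.genus q.2 :=
      ⟨fun ⟨i', hi', h⟩ => by rwa [hi.unique hi'], fun h => ⟨i, hi, h⟩⟩
    rw [hg]
    by_cases hr : RootOnTwoFaces ρ.1 X.root ↔ s = true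
    · have h := T.amalgamRotation_spec (c := q.1) ha hb he hi q.2
        (hs.imp_right fun h => by rw [hr, h]; simp)
      simp only [Q, h.1, h.2, Bool.coe_iff_coe]
      tauto
    · tauto
  have htwist : ∀ (j : Bool) (p : P),
      Nat.card {ρ // Q (.inr j, p) ρ ∧ (RootOnTwoFaces ρ.1 X.root ↔ true = true)} =
        if T.twistedTwoFaces p = t then
          shift (T.twistedGenus p) (partialCount X.graph X.root true) k else 0 := by
    intro j p
    unfold partialCount
    rw [← nat_card_shift
      (fun (ρ : {ρ : Perm X.graph.Dart // IsRotationSystem X.graph ρ}) i => HasGenus ρ.1 i), ← nat_card_and_const]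
    refine Nat.card_congr (Equiv.subtypeEquivRight fun ρ => ?_)
    obtain ⟨i, hi⟩ := hX ρ.1 ρ.2
    have hg : (∃ i, HasGenus ρ.1 i ∧ k = i + T.twistedGenus p) ↔ k = i + T.twistedGenus p :=
      ⟨fun ⟨i', hi', h⟩ => by rwa [hi.unique hi'], fun h => ⟨i, hi, h⟩⟩
    rw [hg]
    by_cases hr : RootOnTwoFaces ρ.1 X.root
    · have h := T.amalgamRotation_spec_twisted (b := b) ha he hi p j hr
      simp only [Q, h.1, h.2, Bool.coe_iff_coe]
      tauto
    · simp [hr]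
  have hsplit : ∀ q, Nat.card {ρ // Q q ρ} =
      Nat.card {ρ // Q q ρ ∧ (RootOnTwoFaces ρ.1 X.root ↔ true = true)} +
      Nat.card {ρ // Q q ρ ∧ (RootOnTwoFaces ρ.1 X.root ↔ false = true)} := fun q => by
    rw [nat_card_subtype_add_not (Q q) fun ρ => RootOnTwoFaces ρ.1 X.root]
    simp
  have hcount : partialCount (amalgamate X H).graph (amalgamate X H).root t k =
      ∑ q, Nat.card {ρ // Q q ρ} := by
    let E := ((Equiv.refl ((Bool × Bool) ⊕ Bool)).prodCongr T.rotation).prodCongr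
      (Equiv.refl {ρ : Perm X.graph.Dart // IsRotationSystem X.graph ρ}) |>.trans
        (Equiv.ofBijective _ (amalgamRotation_bijective ha hb))
    rw [← Nat.card_sigma, ← Nat.card_congr (Equiv.subtypeProdEquivSigmaSubtype Q)]
    exact (Nat.card_congr (E.subtypeEquiv fun x => Iff.rfl)).symm
  rw [hcount, Fintype.sum_prod_type_right]
  refine Finset.sum_congr rfl fun p _ => ?_
  rw [Fintype.sum_sum_type, Fintype.sum_prod_type]
  have h1 : ∀ c, Nat.card {ρ // Q (.inl c, p) ρ} =
      (if T.twoFaces p = t then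
        shift (T.genus p) (partialCount X.graph X.root true) k else 0) +
      if T.twoFaces p = t then
        shift (T.genus p) (partialCount X.graph X.root false) k else 0 := fun c => by
    rw [hsplit, hplain _ true (.inl ⟨_, rfl⟩), hplain _ false (.inl ⟨_, rfl⟩)]
  have h2 : ∀ j, Nat.card {ρ // Q (.inr j, p) ρ} =
      (if T.twistedTwoFaces p = t then
        shift (T.twistedGenus p) (partialCount X.graph X.root true) k else 0) +
      if T.twoFaces p = t then
        shift (T.genus p) (partialCount X.graph X.root false) k else 0 := fun j => by
    rw [hsplit, htwist, hplain _ false (.inr rfl)]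
  simp only [Fintype.sum_bool, h1, h2]
  split_ifs <;> ring

end Recursion

/-! ### Counting cycles by computation -/

section Computation

variable {N : ℕ}

/-- Whether `x` is at most each of the first `k` iterates of `z` under `f`. -/
def isLeIterates (f : ℕ → ℕ) (x : ℕ) : ℕ → ℕ → Bool
  | 0, _ => true
  | k + 1, z => Nat.ble x z && isLeIterates f x k (f z)

/-- The number of `x < n` that are minimal among their first `l` iterates under `f`. -/
def countMinimal (f : ℕ → ℕ) (l : ℕ) : ℕ → ℕ
  | 0 => 0
  | n + 1 => cond (isLeIterates f n l n) (countMinimal f l n + 1) (countMinimal f l n)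

/-- Whether `y` is among the first `k` iterates of `x` under `f`. -/
def isIterate (f : ℕ → ℕ) (y : ℕ) : ℕ → ℕ → Bool
  | 0, _ => false
  | k + 1, x => Nat.beq x y || isIterate f y k (f x)

theorem isLeIterates_iff (f : ℕ → ℕ) (x k z : ℕ) :
    isLeIterates f x k z = true ↔ ∀ j < k, x ≤ f^[j] z := by
  induction k generalizing z with
  | zero => simp [isLeIterates]
  | succ k ih =>
    rw [isLeIterates, Bool.and_eq_true, Nat.ble_eq, ih, Nat.forall_lt_succ_left]
    rfl

theorem isIterate_iff (f : ℕ → ℕ) (y k x : ℕ) :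
    isIterate f y k x = true ↔ ∃ j < k, f^[j] x = y := by
  induction k generalizing x with
  | zero => simp [isIterate]
  | succ k ih =>
    rw [isIterate, Bool.or_eq_true, Nat.beq_eq, ih, Nat.exists_lt_succ_left]
    rfl

theorem countMinimal_eq (f : ℕ → ℕ) (l n : ℕ) :
    countMinimal f l n = Nat.count (fun x => isLeIterates f x l x = true) n := by
  induction n with
  | zero => rfl
  | succ n ih =>
    rw [countMinimal, Nat.count_succ, ih]
    cases isLeIterates f n l n <;> rfl

theorem val_iterate {σ : Perm (Fin N)} {f : ℕ → ℕ} (hf : ∀ i, (σ i).1 = f i.1) (j : ℕ)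
    (x : Fin N) : ((σ ^ j) x).1 = f^[j] x.1 := by
  induction j with
  | zero => rfl
  | succ j ih => rw [pow_succ', Perm.mul_apply, hf, ih, Function.iterate_succ_apply']

theorem sameCycle_iff_isIterate {σ : Perm (Fin N)} {f : ℕ → ℕ} (hf : ∀ i, (σ i).1 = f i.1)
    (x y : Fin N) : σ.SameCycle x y ↔ isIterate f y.1 (N + 2) x.1 = true := by
  rw [isIterate_iff]
  constructor
  · intro h
    obtain ⟨j, -, hj, hy⟩ := h.exists_pow_eq
    -- An iterate with exponent at most one more than the length of the cycle takes `x` to `y`.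
    have : (σ.cycleOf x).support.card ≤ N := by
      simpa using Finset.card_le_univ (σ.cycleOf x).support
    exact ⟨j, by omega, by rw [← val_iterate hf, hy]⟩
  · rintro ⟨j, -, hj⟩
    rw [← val_iterate hf] at hj
    rw [← Fin.ext hj]
    exact sameCycle_pow_right.2 (.refl _ _)

/-- Each cycle has exactly one minimal element. -/
theorem numCycles_eq_countMinimal {σ : Perm (Fin N)} {f : ℕ → ℕ}
    (hf : ∀ i, (σ i).1 = f i.1) : numCycles σ = countMinimal f (N + 2) N := by
  classical
  have hmin : ∀ x : Fin N, isLeIterates f x.1 (N + 2) x.1 = true ↔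
      ∀ y, σ.SameCycle x y → x ≤ y := by
    intro x
    simp only [isLeIterates_iff, sameCycle_iff_isIterate hf, isIterate_iff]
    constructor
    · rintro h y ⟨j, hj, hy⟩
      have := h j hj
      rwa [hy] at this
    · intro h j hj
      have := h ((σ ^ j) x) ⟨j, hj, (val_iterate hf j x).symm⟩
      rwa [Fin.le_def, val_iterate hf] at this
  let g : {x : Fin N // isLeIterates f x.1 (N + 2) x.1 = true} →
      Quotient (SameCycle.setoid σ) := fun x => Quotient.mk _ x.1
  have hg : Function.Bijective g := by
    constructor
    · rintro ⟨x, hx⟩ ⟨y, hy⟩ h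
      have h' : σ.SameCycle x y := Quotient.exact h
      rw [hmin] at hx hy
      exact Subtype.ext (le_antisymm (hx y h') (hy x h'.symm))
    · intro q
      induction q using Quotient.inductionOn with | _ x
      obtain ⟨y, hy, hle⟩ := Set.exists_min_image {y | σ.SameCycle x y} id (Set.toFinite _)
        ⟨x, SameCycle.refl _ _⟩
      exact ⟨⟨y, (hmin y).2 fun z hz => hle z (SameCycle.trans hy hz)⟩,
        Quotient.sound (SameCycle.symm hy)⟩
  rw [numCycles, ← Nat.card_congr (Equiv.ofBijective g hg), countMinimal_eq,
    Nat.card_eq_fintype_card, Nat.count_eq_card_filter_range, Fintype.card_subtype]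
  refine Finset.card_bij (fun x _ => x.1) ?_ ?_ ?_
  · intro x hx
    simpa using hx
  · intro x _ y _ h
    exact Fin.ext h
  · intro x hx
    rw [Finset.mem_filter, Finset.mem_range] at hx
    exact ⟨⟨x, hx.1⟩, by simpa using hx.2, rfl⟩

/-- The `i`-th digit of `t` in base 32. -/
def digit (t i : ℕ) : ℕ := t / 32 ^ i % 32

/-- The number with the given digits in base 32, the lowest first; this stores a table of small
numbers in a form in which look-ups are fast. -/
def pack (l : List ℕ) : ℕ := l.foldr (fun d t => d + 32 * t) 0

theorem digit_pack (l : List ℕ) (hl : ∀ x ∈ l, x < 32) (i : ℕ) :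
    digit (pack l) i = l.getD i 0 := by
  induction l generalizing i with
  | nil => simp [digit, pack]
  | cons d l ih =>
    have hd : d < 32 := hl d (by simp)
    cases i with
    | zero =>
      change (d + 32 * pack l) / 32 ^ 0 % 32 = d
      omega
    | succ i =>
      rw [List.getD_cons_succ, ← ih fun x hx => hl x (List.mem_cons_of_mem _ hx)]
      change (d + 32 * pack l) / 32 ^ (i + 1) % 32 = pack l / 32 ^ i % 32
      rw [pow_succ', ← Nat.div_div_eq_div_mul]
      congr 2
      omega

end Computation

/-! ### Enumerated rotation systems -/

section Enumeration

variable {V : Type*} {N : ℕ} {P : Type*}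

/-- An enumeration of the darts of a graph and of its rotation systems. The darts `2 k` and
`2 k + 1` belong to one edge; the rotation with parameter `p` takes the `i`-th dart to the one whose
number is the `i`-th digit of `code p`; `inv p` is the parameter of the inverse rotation, and
`base v` is a dart at `v` from which the rotations reach the other darts at `v`. -/
structure RotationTable (G : SimpleGraph V) (N : ℕ) (P : Type*) where
  dart : Fin N ≃ G.Dart
  val_symm : ∀ i, (dart.symm (dart i).symm).1 = i.1 ^^^ 1
  code : P → ℕ
  inv : P → P
  base : V → Fin N
  code_lt : ∀ p (i : Fin N), digit (code p) i < N
  code_inv : ∀ p (i : Fin N), digit (code (inv p)) (digit (code p) i) = i.1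
  code_injective : ∀ p q, (∀ i : Fin N, digit (code p) i = digit (code q) i) → p = q
  tail_code : ∀ p (i : Fin N), (dart ⟨digit (code p) i, code_lt p i⟩).fst = (dart i).fst
  exists_iterate : ∀ p i, ∃ k, (digit (code p))^[k] (base (dart i).fst) = i.1
  complete : ∀ ρ : Perm (Fin N), IsRotation (fun i => (dart i).fst) ρ →
    ∃ p, ∀ i, (ρ i).1 = digit (code p) i

namespace RotationTable

variable {G : SimpleGraph V} (T : RotationTable G N P)

/-- The rotation of the numbered darts with parameter `p`. -/
noncomputable def perm (p : P) : Perm (Fin N) :=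
  Equiv.ofBijective (fun i => ⟨digit (T.code p) i, T.code_lt p i⟩) <|
    Finite.injective_iff_bijective.1 fun i j h => by
      rw [Fin.ext_iff, ← T.code_inv p i, ← T.code_inv p j,
        show digit (T.code p) i = digit (T.code p) j from congrArg Fin.val h]

theorem isRotation_perm (p : P) : IsRotation (fun i => (T.dart i).fst) (T.perm p) := by
  intro i j
  constructor
  · intro h
    exact SameCycle.rel (Setoid.ker fun i => (T.dart i).fst) (fun z => (T.tail_code p z).symm) h
  · intro h
    have key : ∀ i, (T.perm p).SameCycle (T.base (T.dart i).fst) i := fun i => by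
      obtain ⟨k, hk⟩ := T.exists_iterate p i
      rw [← val_iterate (σ := T.perm p) fun _ => rfl] at hk
      have h1 : (T.perm p).SameCycle (T.base (T.dart i).fst)
          ((T.perm p ^ k) (T.base (T.dart i).fst)) := sameCycle_pow_right.2 (.refl _ _)
      rwa [Fin.ext hk] at h1
    have h2 := key i
    rw [show (T.dart i).fst = (T.dart j).fst from h] at h2
    exact h2.symm.trans (key j)

theorem isRotationSystem_permCongr (ρ : Perm (Fin N)) :
    IsRotationSystem G (T.dart.permCongr ρ) ↔ IsRotation (fun i => (T.dart i).fst) ρ := by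
  constructor
  · intro h d e
    have := h (T.dart d) (T.dart e)
    rwa [sameCycle_permCongr, symm_apply_apply, symm_apply_apply] at this
  · intro h d e
    rw [sameCycle_permCongr, h]
    simp only [apply_symm_apply]

/-- The parameters enumerate the rotation systems. -/
noncomputable def rotation : P ≃ {ρ : Perm G.Dart // IsRotationSystem G ρ} :=
  Equiv.ofBijective
    (fun p => ⟨T.dart.permCongr (T.perm p),
      (T.isRotationSystem_permCongr _).2 (T.isRotation_perm p)⟩) <| by
    constructor
    · intro p q h
      have h' := T.dart.permCongr.injective (congrArg Subtype.val h)
      exact T.code_injective p q fun i =>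
        congrArg (fun σ : Perm (Fin N) => (σ i).1) h'
    · rintro ⟨ρ, hρ⟩
      obtain ⟨ρ, rfl⟩ := T.dart.permCongr.surjective ρ
      obtain ⟨p, hp⟩ := T.complete ρ ((T.isRotationSystem_permCongr ρ).1 hρ)
      exact ⟨p, Subtype.ext (congrArg T.dart.permCongr
        (Equiv.ext fun i => Fin.ext (hp i).symm))⟩

/-- The face permutation on the numbers of the darts. -/
def face (p : P) (i : ℕ) : ℕ := digit (T.code p) (i ^^^ 1)

theorem facePerm_spec (p : P) (i : Fin N) :
    (T.dart.symm.permCongr (facePerm (T.rotation p).1) i).1 = T.face p i := by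
  rw [Equiv.permCongr_apply, symm_symm]
  change (T.dart.symm (T.dart (T.perm p (T.dart.symm (T.dart i).symm)))).1 = _
  rw [symm_apply_apply, face, ← T.val_symm]
  rfl

theorem numCycles_eq {φ : Perm G.Dart} {f : ℕ → ℕ}
    (hf : ∀ i, (T.dart.symm.permCongr φ i).1 = f i.1) :
    numCycles φ = countMinimal f (N + 2) N := by
  rw [← numCycles_permCongr T.dart.symm, numCycles_eq_countMinimal hf]

theorem sameCycle_iff {φ : Perm G.Dart} {f : ℕ → ℕ}
    (hf : ∀ i, (T.dart.symm.permCongr φ i).1 = f i.1) (i j : Fin N) :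
    φ.SameCycle (T.dart i) (T.dart j) ↔ isIterate f j.1 (N + 2) i.1 = true := by
  rw [← sameCycle_iff_isIterate hf, sameCycle_permCongr]
  simp

theorem swap_mul_facePerm_spec [DecidableEq G.Dart] (b b' : Fin N) (p : P) {f : ℕ → ℕ}
    (hf : ∀ i : Fin N, f i.1 =
      if T.face p i = b.1 then b'.1 else if T.face p i = b'.1 then b.1 else T.face p i)
    (i : Fin N) :
    (T.dart.symm.permCongr (swap (T.dart b) (T.dart b') * facePerm (T.rotation p).1) i).1 =
      f i.1 := by
  have h : T.dart.symm.permCongr (swap (T.dart b) (T.dart b') * facePerm (T.rotation p).1) i =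
      swap b b' (T.dart.symm.permCongr (facePerm (T.rotation p).1) i) := by
    rw [Equiv.permCongr_apply, Equiv.permCongr_apply, Perm.mul_apply, T.dart.symm_apply_eq,
      swap_apply_def, swap_apply_def]
    simp [Equiv.symm_apply_eq, apply_ite T.dart]
  rw [h, hf, swap_apply_def, ← facePerm_spec]
  simp only [Fin.ext_iff]
  split_ifs <;> rfl

end RotationTable

end Enumeration

/-! ### The two rooted wheels -/

section Wheels

/-- The enumeration of the darts of a graph by their tails and heads. -/
noncomputable def dartEquiv {V : Type*} {G : SimpleGraph V} {N : ℕ} (tail head : Fin N → V)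
    (hadj : ∀ i, G.Adj (tail i) (head i))
    (hinj : ∀ i j, tail i = tail j → head i = head j → i = j)
    (hsurj : ∀ v w, G.Adj v w → ∃ i, tail i = v ∧ head i = w) : Fin N ≃ G.Dart :=
  Equiv.ofBijective (fun i => ⟨(tail i, head i), hadj i⟩) <| by
    constructor
    · intro i j h
      exact hinj i j (congrArg (fun d => d.toProd.1) h) (congrArg (fun d => d.toProd.2) h)
    · rintro ⟨⟨v, w⟩, h⟩
      obtain ⟨i, rfl, rfl⟩ := hsurj v w h
      exact ⟨i, rfl⟩

/-- The parameters of a rotation system of a subdivided wheel: one of six cyclic orders at the hub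
and an orientation at each of the four trivalent vertices. -/
abbrev WheelRotation : Type := Fin 6 × Bool × Bool × Bool × Bool

/-- The six cyclic orders at the hub, as successor functions on the four darts `0, 2, 4, 6` there,
which are numbered by `i`. -/
def hubSucc (c : Fin 6) (i : ℕ) : ℕ :=
  digit ([pack [2, 4, 6, 0], pack [2, 6, 0, 4], pack [4, 6, 2, 0], pack [4, 0, 6, 2],
    pack [6, 4, 0, 2], pack [6, 0, 2, 4]].getD c.1 0) i

/-- The parameters of the inverse rotation system. -/
def WheelRotation.inv (p : WheelRotation) : WheelRotation :=
  ([5, 3, 4, 1, 2, 0].getD p.1 0, !p.2.1, !p.2.2.1, !p.2.2.2.1, !p.2.2.2.2)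

theorem hubSucc_injective : ∀ c c' : Fin 6, hubSucc c 0 = hubSucc c' 0 →
    hubSucc c 1 = hubSucc c' 1 → hubSucc c 2 = hubSucc c' 2 → c = c' := by
  decide +kernel

/-- The tails of the darts of `wheelDoublyRooted`. -/
def tailH (i : Fin 20) : Fin 7 :=
  Fin.ofNat 7 (digit (pack [0, 1, 0, 2, 0, 3, 0, 4, 1, 5, 5, 2, 4, 1, 2, 3, 3, 6, 6, 4]) i)

/-- The heads of the darts of `wheelDoublyRooted`. -/
def headH (i : Fin 20) : Fin 7 :=
  Fin.ofNat 7 (digit (pack [1, 0, 2, 0, 3, 0, 4, 0, 5, 1, 2, 5, 1, 4, 3, 2, 6, 3, 4, 6]) i)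

/-- The successor tables of the rotation systems of `wheelDoublyRooted`, except that the successors
of the darts `9` and `10` at the first root are left open. -/
def tableH (s t : ℕ) (p : WheelRotation) : List ℕ :=
  [hubSucc p.1 0, cond p.2.1 13 8, hubSucc p.1 1, cond p.2.2.1 14 11, hubSucc p.1 2,
    cond p.2.2.2.1 16 15, hubSucc p.1 3, cond p.2.2.2.2 19 12, cond p.2.1 1 13, s, t,
    cond p.2.2.1 3 14, cond p.2.2.2.2 7 19, cond p.2.1 8 1, cond p.2.2.1 11 3,
    cond p.2.2.2.1 5 16, cond p.2.2.2.1 15 5, 18, 17, cond p.2.2.2.2 12 7]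

/-- The packed form of `tableH`. -/
def codeH (s t : ℕ) (p : WheelRotation) : ℕ := pack (tableH s t p)

theorem hubSucc_lt (c : Fin 6) (i : ℕ) : hubSucc c i < 32 := Nat.mod_lt _ (by decide)

theorem cond_lt {b : Bool} {m n k : ℕ} (hm : m < k) (hn : n < k) : cond b m n < k := by
  cases b <;> assumption

theorem cond_injective (b b' : Bool) (m n : ℕ) (hmn : m ≠ n) (h : cond b m n = cond b' m n) :
    b = b' := by
  cases b <;> cases b'
  exacts [rfl, absurd h.symm hmn, absurd h hmn, rfl]

theorem forall_mem_tableH (s t : ℕ) (p : WheelRotation) (hs : s < 32) (ht : t < 32) :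
    ∀ x ∈ tableH s t p, x < 32 := by
  simp [tableH, hubSucc_lt, cond_lt, hs, ht]

theorem adjH : ∀ i, wheelDoublyRooted.graph.Adj (tailH i) (headH i) := by
  intro i
  simp only [wheelDoublyRooted, SimpleGraph.fromEdgeSet_adj, Set.mem_insert_iff,
    Set.mem_singleton_iff]
  revert i
  decide +kernel

theorem injH : ∀ i j, tailH i = tailH j → headH i = headH j → i = j := by
  decide +kernel

theorem surjH : ∀ v w, wheelDoublyRooted.graph.Adj v w → ∃ i, tailH i = v ∧ headH i = w := by
  intro v w
  simp only [wheelDoublyRooted]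
  revert v w
  change ∀ v w : Fin 7, _
  decide +kernel

theorem codeH_spec : ∀ p (i : Fin 20), digit (codeH 10 9 p) i < 20 ∧
    digit (codeH 10 9 p.inv) (digit (codeH 10 9 p) i) = i.1 ∧
    tailH (Fin.ofNat 20 (digit (codeH 10 9 p) i)) = tailH i := by
  decide +kernel

/-- A dart with given tail. -/
def baseH (v : Fin 7) : Fin 20 := Fin.ofNat 20 (digit (pack [0, 1, 3, 5, 7, 9, 17]) v)

theorem exists_iterateH : ∀ p (i : Fin 20), ∃ k : Fin 4,
    (digit (codeH 10 9 p))^[k] (baseH (tailH i)) = i.1 := by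
  decide +kernel

theorem completeH (ρ : Perm (Fin 20)) (hρ : IsRotation tailH ρ) :
    ∃ p, ∀ i, (ρ i).1 = digit (codeH 10 9 p) i := by
  have h0 := hρ.apply_of_four (a := 0) (b := 2) (c := 4) (d := 6)
    (by decide) (by decide) (by decide) (by decide) (by decide) (by decide) (by decide +kernel)
  have h1 := hρ.apply_of_three (a := 1) (b := 8) (c := 13)
    (by decide) (by decide) (by decide) (by decide +kernel)
  have h2 := hρ.apply_of_three (a := 3) (b := 11) (c := 14)
    (by decide) (by decide) (by decide) (by decide +kernel)
  have h3 := hρ.apply_of_three (a := 5) (b := 15) (c := 16)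
    (by decide) (by decide) (by decide) (by decide +kernel)
  have h4 := hρ.apply_of_three (a := 7) (b := 12) (c := 19)
    (by decide) (by decide) (by decide) (by decide +kernel)
  have h5 := hρ.apply_of_two (a := 9) (b := 10) (by decide) (by decide +kernel)
  have h6 := hρ.apply_of_two (a := 17) (b := 18) (by decide) (by decide +kernel)
  obtain ⟨c, hc⟩ : ∃ c, (ρ 0).1 = hubSucc c 0 ∧ (ρ 2).1 = hubSucc c 1 ∧ (ρ 4).1 = hubSucc c 2 ∧
      (ρ 6).1 = hubSucc c 3 := by
    rcases h0 with h | h | h | h | h | h <;> rw [h.1, h.2.1, h.2.2.1, h.2.2.2] <;> decide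
  obtain ⟨b₁, hb₁⟩ : ∃ b, (ρ 1).1 = cond b 13 8 ∧ (ρ 8).1 = cond b 1 13 ∧
      (ρ 13).1 = cond b 8 1 := by
    rcases h1 with h | h <;> rw [h.1, h.2.1, h.2.2] <;> decide
  obtain ⟨b₂, hb₂⟩ : ∃ b, (ρ 3).1 = cond b 14 11 ∧ (ρ 11).1 = cond b 3 14 ∧
      (ρ 14).1 = cond b 11 3 := by
    rcases h2 with h | h <;> rw [h.1, h.2.1, h.2.2] <;> decide
  obtain ⟨b₃, hb₃⟩ : ∃ b, (ρ 5).1 = cond b 16 15 ∧ (ρ 15).1 = cond b 5 16 ∧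
      (ρ 16).1 = cond b 15 5 := by
    rcases h3 with h | h <;> rw [h.1, h.2.1, h.2.2] <;> decide
  obtain ⟨b₄, hb₄⟩ : ∃ b, (ρ 7).1 = cond b 19 12 ∧ (ρ 12).1 = cond b 7 19 ∧
      (ρ 19).1 = cond b 12 7 := by
    rcases h4 with h | h <;> rw [h.1, h.2.1, h.2.2] <;> decide
  refine ⟨(c, b₁, b₂, b₃, b₄), fun i => ?_⟩
  rw [codeH, digit_pack _ (forall_mem_tableH _ _ _ (by decide) (by decide))]
  fin_cases i
  exacts [hc.1, hb₁.1, hc.2.1, hb₂.1, hc.2.2.1, hb₃.1, hc.2.2.2, hb₄.1, hb₁.2.1,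
    congrArg Fin.val h5.1, congrArg Fin.val h5.2, hb₂.2.1, hb₄.2.1, hb₁.2.2, hb₂.2.2, hb₃.2.1,
    hb₃.2.2, congrArg Fin.val h6.1, congrArg Fin.val h6.2, hb₄.2.2]

theorem injectiveH (p q : WheelRotation)
    (h : ∀ i : Fin 20, digit (codeH 10 9 p) i = digit (codeH 10 9 q) i) : p = q := by
  have h' : ∀ i : Fin 20, (tableH 10 9 p).getD i.1 0 = (tableH 10 9 q).getD i.1 0 := fun i => by
    rw [← digit_pack _ (forall_mem_tableH _ _ _ (by decide) (by decide)),
      ← digit_pack _ (forall_mem_tableH _ _ _ (by decide) (by decide))]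
    exact h i
  obtain ⟨c, b₁, b₂, b₃, b₄⟩ := p
  obtain ⟨c', b₁', b₂', b₃', b₄'⟩ := q
  rw [hubSucc_injective c c' (h' 0) (h' 2) (h' 4), cond_injective b₁ b₁' 13 8 (by decide) (h' 1),
    cond_injective b₂ b₂' 14 11 (by decide) (h' 3), cond_injective b₃ b₃' 16 15 (by decide) (h' 5),
    cond_injective b₄ b₄' 19 12 (by decide) (h' 7)]

/-- The darts of `wheelDoublyRooted`. -/
noncomputable def dartH : Fin 20 ≃ wheelDoublyRooted.graph.Dart :=
  dartEquiv (G := wheelDoublyRooted.graph) tailH headH adjH injH surjH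

theorem dartH_symm (i : Fin 20) : (dartH.symm (dartH i).symm).1 = i.1 ^^^ 1 := by
  have h : ∀ i : Fin 20, i.1 ^^^ 1 < 20 ∧ tailH (Fin.ofNat 20 (i.1 ^^^ 1)) = headH i ∧
      headH (Fin.ofNat 20 (i.1 ^^^ 1)) = tailH i := by decide +kernel
  obtain ⟨h1, h2, h3⟩ := h i
  have : (dartH i).symm = dartH (Fin.ofNat 20 (i.1 ^^^ 1)) :=
    SimpleGraph.Dart.ext _ _ (Prod.ext h2.symm h3.symm)
  rw [this, symm_apply_apply]
  exact Nat.mod_eq_of_lt h1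

/-- The rotation systems of `wheelDoublyRooted`. -/
noncomputable def rotationTableH :
    RotationTable wheelDoublyRooted.graph 20 WheelRotation where
  dart := dartH
  val_symm := dartH_symm
  code := codeH 10 9
  inv := WheelRotation.inv
  base := baseH
  code_lt p i := (codeH_spec p i).1
  code_inv p i := (codeH_spec p i).2.1
  code_injective := injectiveH
  tail_code p i := by
    have h := (codeH_spec p i).2.2
    rwa [show Fin.ofNat 20 (digit (codeH 10 9 p) i) = ⟨_, (codeH_spec p i).1⟩ from
      Fin.ext (Nat.mod_eq_of_lt (codeH_spec p i).1)] at h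
  exists_iterate p i := (exists_iterateH p i).elim fun k h => ⟨k.1, h⟩
  complete := completeH

/-- The darts at the first root. -/
theorem isRootPair_fstRoot : IsRootPair (fun d : wheelDoublyRooted.graph.Dart => d.fst)
    wheelDoublyRooted.fstRoot (fun i => rotationTableH.dart (cond i 10 9)) where
  ne := rotationTableH.dart.injective.ne (by decide)
  tail_eq_iff d := by
    obtain ⟨i, rfl⟩ := rotationTableH.dart.surjective d
    rw [rotationTableH.dart.apply_eq_iff_eq, rotationTableH.dart.apply_eq_iff_eq]
    change tailH i = 5 ↔ i = 9 ∨ i = 10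
    revert i
    decide +kernel

/-- The darts at the second root. -/
theorem isRootPair_sndRoot : IsRootPair (fun d : wheelDoublyRooted.graph.Dart => d.fst)
    wheelDoublyRooted.sndRoot (fun i => rotationTableH.dart (cond i 18 17)) where
  ne := rotationTableH.dart.injective.ne (by decide)
  tail_eq_iff d := by
    obtain ⟨i, rfl⟩ := rotationTableH.dart.surjective d
    rw [rotationTableH.dart.apply_eq_iff_eq, rotationTableH.dart.apply_eq_iff_eq]
    change tailH i = 6 ↔ i = 17 ∨ i = 18
    revert i
    decide +kernel

/-- The number of faces of an embedding of `wheelDoublyRooted`. -/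
def facesH (p : WheelRotation) : ℕ := countMinimal (fun i => digit (codeH 10 9 p) (i ^^^ 1)) 22 20

/-- The number of cycles of the face permutation multiplied by the transposition at the first
root; with this factor, the successor table has the fixed points `9` and `10`. -/
def twistedFacesH (p : WheelRotation) : ℕ :=
  countMinimal (fun i => digit (codeH 9 10 p) (i ^^^ 1)) 22 20

/-- Whether two faces are incident on the second root. -/
def twoFacesH (p : WheelRotation) : Bool :=
  !isIterate (fun i => digit (codeH 10 9 p) (i ^^^ 1)) 18 22 17

/-- The same for the face permutation multiplied by the transposition at the first root. -/
def twistedTwoFacesH (p : WheelRotation) : Bool :=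
  !isIterate (fun i => digit (codeH 9 10 p) (i ^^^ 1)) 18 22 17

/-- Number of faces and type of the second root for the 96 embeddings. -/
theorem statsH : Finset.univ.val.map (fun p => (facesH p, twoFacesH p)) =
    Multiset.replicate 2 (5, true) + Multiset.replicate 44 (3, true) +
      Multiset.replicate 14 (3, false) + Multiset.replicate 36 (1, false) := by
  decide +kernel

/-- The same for the face permutations multiplied by the transposition at the first root. -/
theorem twistedStatsH : Finset.univ.val.map (fun p => (twistedFacesH p, twistedTwoFacesH p)) =
    Multiset.replicate 16 (4, true) + Multiset.replicate 32 (2, true) +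
      Multiset.replicate 48 (2, false) := by
  decide +kernel

theorem sum_eq_of_map_eq {P β : Type*} [Fintype P] {s : P → β} {m : Multiset β}
    (h : Finset.univ.val.map s = m) (F : β → ℕ) : ∑ p, F (s p) = (m.map F).sum := by
  rw [← h, Multiset.map_map]
  rfl

theorem facesH_spec (p : WheelRotation) :
    facesH p = 5 ∨ facesH p = 3 ∨ facesH p = 1 := by
  have h := Multiset.mem_map_of_mem (fun p => (facesH p, twoFacesH p)) (Finset.mem_univ_val p)
  rw [statsH] at h
  simp only [Multiset.mem_add, Multiset.mem_replicate, Prod.mk.injEq] at h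
  omega

theorem twistedFacesH_spec (p : WheelRotation) :
    twistedFacesH p = 4 ∨ twistedFacesH p = 2 := by
  have h := Multiset.mem_map_of_mem (fun p => (twistedFacesH p, twistedTwoFacesH p))
    (Finset.mem_univ_val p)
  rw [twistedStatsH] at h
  simp only [Multiset.mem_add, Multiset.mem_replicate, Prod.mk.injEq] at h
  omega

theorem nat_card_edgeSet_of_dart {V : Type*} [Finite V] {G : SimpleGraph V} {N : ℕ}
    (D : Fin N ≃ G.Dart) : 2 * Nat.card G.edgeSet = N := by
  rw [← nat_card_dart, ← Nat.card_congr D, Nat.card_fin]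

theorem nat_card_edgeSet_wheelDoublyRooted : Nat.card wheelDoublyRooted.graph.edgeSet = 10 := by
  have := wheelDoublyRooted.finite
  have := nat_card_edgeSet_of_dart dartH
  omega

theorem twistedFace_spec [DecidableEq wheelDoublyRooted.graph.Dart] (p : WheelRotation)
    (i : Fin 20) : (rotationTableH.dart.symm.permCongr
      (swap (rotationTableH.dart 9) (rotationTableH.dart 10) *
        facePerm (rotationTableH.rotation p).1) i).1 = digit (codeH 9 10 p) (i.1 ^^^ 1) := by
  have h : ∀ p (i : Fin 20), digit (codeH 9 10 p) i =
      if digit (codeH 10 9 p) i = 9 then 10 else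
        if digit (codeH 10 9 p) i = 10 then 9 else digit (codeH 10 9 p) i := by
    decide +kernel
  refine rotationTableH.swap_mul_facePerm_spec 9 10 p (f := fun i => digit (codeH 9 10 p) (i ^^^ 1))
    (fun i => ?_) i
  have hi : ∀ i : Fin 20, i.1 ^^^ 1 < 20 := by decide
  exact h p ⟨i.1 ^^^ 1, hi i⟩

/-- The transfer data of the doubly rooted wheel. -/
noncomputable def transferH [DecidableEq wheelDoublyRooted.graph.Dart] :
    TransferData wheelDoublyRooted (fun i => rotationTableH.dart (cond i 10 9))
      (fun i => rotationTableH.dart (cond i 18 17)) WheelRotation where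
  rotation := rotationTableH.rotation
  genus p := (5 - facesH p) / 2
  hasGenus p := by
    have h : numFaces (rotationTableH.rotation p).1 = facesH p :=
      rotationTableH.numCycles_eq (rotationTableH.facePerm_spec p)
    have hV : Nat.card wheelDoublyRooted.V = 7 := Nat.card_fin 7
    rw [HasGenus, h, nat_card_edgeSet_wheelDoublyRooted, hV]
    have := facesH_spec p
    omega
  twoFaces := twoFacesH
  twoFaces_iff p := by
    rw [rotationTableH.sameCycle_iff (rotationTableH.facePerm_spec p), twoFacesH,
      Bool.not_eq_true, Bool.not_eq_true']
    rfl
  twistedGenus p := (6 - twistedFacesH p) / 2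
  hasTwistedGenus p := by
    have h : numCycles _ = twistedFacesH p := rotationTableH.numCycles_eq (twistedFace_spec p)
    have hV : Nat.card wheelDoublyRooted.V = 7 := Nat.card_fin 7
    rw [nat_card_edgeSet_wheelDoublyRooted, hV]
    change 7 + numCycles (swap (rotationTableH.dart 9) (rotationTableH.dart 10) * _) + _ = _
    rw [h]
    have := twistedFacesH_spec p
    omega
  twistedTwoFaces := twistedTwoFacesH
  twistedTwoFaces_iff p := by
    change ¬ (swap (rotationTableH.dart 9) (rotationTableH.dart 10) * _).SameCycle _ _ ↔ _
    rw [rotationTableH.sameCycle_iff (f := fun i => digit (codeH 9 10 p) (i ^^^ 1))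
      (twistedFace_spec p), twistedTwoFacesH,
      Bool.not_eq_true, Bool.not_eq_true']
    rfl

/-- The recursion of the partial genus distributions along a chain: with generating functions,
`D' = (8 + 208 x + 64 x²) D + (12 + 264 x) S` and `S' = (56 x + 240 x²) D + (84 x + 216 x²) S`. -/
theorem partialCount_amalgamate_wheel {X : RootedGraph} {a : Bool → X.graph.Dart}
    (ha : IsRootPair (fun d : X.graph.Dart => d.fst) X.root a)
    (hX : ∀ ρ, IsRotationSystem X.graph ρ → ∃ i, HasGenus ρ i) (k : ℕ) :
    partialCount (amalgamate X wheelDoublyRooted).graph (amalgamate X wheelDoublyRooted).root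
        true k =
      8 * partialCount X.graph X.root true k + 12 * partialCount X.graph X.root false k +
      208 * shift 1 (partialCount X.graph X.root true) k +
      264 * shift 1 (partialCount X.graph X.root false) k +
      64 * shift 2 (partialCount X.graph X.root true) k ∧
    partialCount (amalgamate X wheelDoublyRooted).graph (amalgamate X wheelDoublyRooted).root
        false k =
      56 * shift 1 (partialCount X.graph X.root true) k +
      84 * shift 1 (partialCount X.graph X.root false) k +
      240 * shift 2 (partialCount X.graph X.root true) k +
      216 * shift 2 (partialCount X.graph X.root false) k := by
  classical
  have h1 : ∀ F : ℕ × Bool → ℕ, ∑ p, F (facesH p, twoFacesH p) =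
      2 * F (5, true) + 44 * F (3, true) + 14 * F (3, false) + 36 * F (1, false) := fun F => by
    rw [sum_eq_of_map_eq statsH]
    simp only [Multiset.map_add, Multiset.map_replicate, Multiset.sum_add, Multiset.sum_replicate,
      smul_eq_mul]
  have h2 : ∀ F : ℕ × Bool → ℕ, ∑ p, F (twistedFacesH p, twistedTwoFacesH p) =
      16 * F (4, true) + 32 * F (2, true) + 48 * F (2, false) := fun F => by
    rw [sum_eq_of_map_eq twistedStatsH]
    simp only [Multiset.map_add, Multiset.map_replicate, Multiset.sum_add, Multiset.sum_replicate,
      smul_eq_mul]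
  have key := fun t =>
    transferH.partialCount_amalgamate ha isRootPair_fstRoot isRootPair_sndRoot hX t k
  simp only [Finset.sum_add_distrib] at key
  have key' := fun t => (key t).trans (congrArg₂ (· + ·)
    (h1 fun v => if v.2 = t then
      4 * shift ((5 - v.1) / 2) (partialCount X.graph X.root true) k +
      6 * shift ((5 - v.1) / 2) (partialCount X.graph X.root false) k else 0)
    (h2 fun v => if v.2 = t then
      2 * shift ((6 - v.1) / 2) (partialCount X.graph X.root true) k else 0))
  have h0 : ∀ a : ℕ → ℕ, shift 0 a k = a k := fun a => by simp [shift]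
  constructor
  · rw [key' true]
    simp only [if_true, if_false, reduceCtorEq, Nat.reduceSub, Nat.reduceDiv, h0]
    ring
  · rw [key' false]
    simp only [if_true, if_false, reduceCtorEq, Nat.reduceSub, Nat.reduceDiv]
    ring

/-- The tails of the darts of `wheelRooted`. -/
def tailG (i : Fin 18) : Fin 6 :=
  Fin.ofNat 6 (digit (pack [0, 1, 0, 2, 0, 3, 0, 4, 1, 5, 5, 2, 4, 1, 2, 3, 3, 4]) i)

/-- The heads of the darts of `wheelRooted`. -/
def headG (i : Fin 18) : Fin 6 :=
  Fin.ofNat 6 (digit (pack [1, 0, 2, 0, 3, 0, 4, 0, 5, 1, 2, 5, 1, 4, 3, 2, 4, 3]) i)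

/-- The successor tables of the rotation systems of `wheelRooted`. -/
def tableG (p : WheelRotation) : List ℕ :=
  [hubSucc p.1 0, cond p.2.1 13 8, hubSucc p.1 1, cond p.2.2.1 14 11, hubSucc p.1 2,
    cond p.2.2.2.1 16 15, hubSucc p.1 3, cond p.2.2.2.2 17 12, cond p.2.1 1 13, 10, 9,
    cond p.2.2.1 3 14, cond p.2.2.2.2 7 17, cond p.2.1 8 1, cond p.2.2.1 11 3,
    cond p.2.2.2.1 5 16, cond p.2.2.2.1 15 5, cond p.2.2.2.2 12 7]

/-- The packed form of `tableG`. -/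
def codeG (p : WheelRotation) : ℕ := pack (tableG p)

theorem forall_mem_tableG (p : WheelRotation) : ∀ x ∈ tableG p, x < 32 := by
  simp [tableG, hubSucc_lt, cond_lt]

theorem adjG : ∀ i, wheelRooted.graph.Adj (tailG i) (headG i) := by
  intro i
  simp only [wheelRooted, SimpleGraph.fromEdgeSet_adj, Set.mem_insert_iff,
    Set.mem_singleton_iff]
  revert i
  decide +kernel

theorem injG : ∀ i j, tailG i = tailG j → headG i = headG j → i = j := by
  decide +kernel

theorem surjG : ∀ v w, wheelRooted.graph.Adj v w → ∃ i, tailG i = v ∧ headG i = w := by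
  intro v w
  simp only [wheelRooted]
  revert v w
  change ∀ v w : Fin 6, _
  decide +kernel

theorem codeG_spec : ∀ p (i : Fin 18), digit (codeG p) i < 18 ∧
    digit (codeG p.inv) (digit (codeG p) i) = i.1 ∧
    tailG (Fin.ofNat 18 (digit (codeG p) i)) = tailG i := by
  decide +kernel

/-- A dart with given tail. -/
def baseG (v : Fin 6) : Fin 18 := Fin.ofNat 18 (digit (pack [0, 1, 3, 5, 7, 9]) v)

theorem exists_iterateG : ∀ p (i : Fin 18), ∃ k : Fin 4,
    (digit (codeG p))^[k] (baseG (tailG i)) = i.1 := by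
  decide +kernel

theorem completeG (ρ : Perm (Fin 18)) (hρ : IsRotation tailG ρ) :
    ∃ p, ∀ i, (ρ i).1 = digit (codeG p) i := by
  have h0 := hρ.apply_of_four (a := 0) (b := 2) (c := 4) (d := 6)
    (by decide) (by decide) (by decide) (by decide) (by decide) (by decide) (by decide +kernel)
  have h1 := hρ.apply_of_three (a := 1) (b := 8) (c := 13)
    (by decide) (by decide) (by decide) (by decide +kernel)
  have h2 := hρ.apply_of_three (a := 3) (b := 11) (c := 14)
    (by decide) (by decide) (by decide) (by decide +kernel)
  have h3 := hρ.apply_of_three (a := 5) (b := 15) (c := 16)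
    (by decide) (by decide) (by decide) (by decide +kernel)
  have h4 := hρ.apply_of_three (a := 7) (b := 12) (c := 17)
    (by decide) (by decide) (by decide) (by decide +kernel)
  have h5 := hρ.apply_of_two (a := 9) (b := 10) (by decide) (by decide +kernel)
  obtain ⟨c, hc⟩ : ∃ c, (ρ 0).1 = hubSucc c 0 ∧ (ρ 2).1 = hubSucc c 1 ∧ (ρ 4).1 = hubSucc c 2 ∧
      (ρ 6).1 = hubSucc c 3 := by
    rcases h0 with h | h | h | h | h | h <;> rw [h.1, h.2.1, h.2.2.1, h.2.2.2] <;> decide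
  obtain ⟨b₁, hb₁⟩ : ∃ b, (ρ 1).1 = cond b 13 8 ∧ (ρ 8).1 = cond b 1 13 ∧
      (ρ 13).1 = cond b 8 1 := by
    rcases h1 with h | h <;> rw [h.1, h.2.1, h.2.2] <;> decide
  obtain ⟨b₂, hb₂⟩ : ∃ b, (ρ 3).1 = cond b 14 11 ∧ (ρ 11).1 = cond b 3 14 ∧
      (ρ 14).1 = cond b 11 3 := by
    rcases h2 with h | h <;> rw [h.1, h.2.1, h.2.2] <;> decide
  obtain ⟨b₃, hb₃⟩ : ∃ b, (ρ 5).1 = cond b 16 15 ∧ (ρ 15).1 = cond b 5 16 ∧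
      (ρ 16).1 = cond b 15 5 := by
    rcases h3 with h | h <;> rw [h.1, h.2.1, h.2.2] <;> decide
  obtain ⟨b₄, hb₄⟩ : ∃ b, (ρ 7).1 = cond b 17 12 ∧ (ρ 12).1 = cond b 7 17 ∧
      (ρ 17).1 = cond b 12 7 := by
    rcases h4 with h | h <;> rw [h.1, h.2.1, h.2.2] <;> decide
  refine ⟨(c, b₁, b₂, b₃, b₄), fun i => ?_⟩
  rw [codeG, digit_pack _ (forall_mem_tableG _)]
  fin_cases i
  exacts [hc.1, hb₁.1, hc.2.1, hb₂.1, hc.2.2.1, hb₃.1, hc.2.2.2, hb₄.1, hb₁.2.1,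
    congrArg Fin.val h5.1, congrArg Fin.val h5.2, hb₂.2.1, hb₄.2.1, hb₁.2.2, hb₂.2.2, hb₃.2.1,
    hb₃.2.2, hb₄.2.2]

theorem injectiveG (p q : WheelRotation)
    (h : ∀ i : Fin 18, digit (codeG p) i = digit (codeG q) i) : p = q := by
  have h' : ∀ i : Fin 18, (tableG p).getD i.1 0 = (tableG q).getD i.1 0 := fun i => by
    rw [← digit_pack _ (forall_mem_tableG _),
      ← digit_pack _ (forall_mem_tableG _)]
    exact h i
  obtain ⟨c, b₁, b₂, b₃, b₄⟩ := p
  obtain ⟨c', b₁', b₂', b₃', b₄'⟩ := q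
  rw [hubSucc_injective c c' (h' 0) (h' 2) (h' 4), cond_injective b₁ b₁' 13 8 (by decide) (h' 1),
    cond_injective b₂ b₂' 14 11 (by decide) (h' 3), cond_injective b₃ b₃' 16 15 (by decide) (h' 5),
    cond_injective b₄ b₄' 17 12 (by decide) (h' 7)]

/-- The darts of `wheelRooted`. -/
noncomputable def dartG : Fin 18 ≃ wheelRooted.graph.Dart :=
  dartEquiv (G := wheelRooted.graph) tailG headG adjG injG surjG

theorem dartG_symm (i : Fin 18) : (dartG.symm (dartG i).symm).1 = i.1 ^^^ 1 := by
  have h : ∀ i : Fin 18, i.1 ^^^ 1 < 18 ∧ tailG (Fin.ofNat 18 (i.1 ^^^ 1)) = headG i ∧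
      headG (Fin.ofNat 18 (i.1 ^^^ 1)) = tailG i := by decide +kernel
  obtain ⟨h1, h2, h3⟩ := h i
  have : (dartG i).symm = dartG (Fin.ofNat 18 (i.1 ^^^ 1)) :=
    SimpleGraph.Dart.ext _ _ (Prod.ext h2.symm h3.symm)
  rw [this, symm_apply_apply]
  exact Nat.mod_eq_of_lt h1

/-- The rotation systems of `wheelRooted`. -/
noncomputable def rotationTableG :
    RotationTable wheelRooted.graph 18 WheelRotation where
  dart := dartG
  val_symm := dartG_symm
  code := codeG
  inv := WheelRotation.inv
  base := baseG
  code_lt p i := (codeG_spec p i).1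
  code_inv p i := (codeG_spec p i).2.1
  code_injective := injectiveG
  tail_code p i := by
    have h := (codeG_spec p i).2.2
    rwa [show Fin.ofNat 18 (digit (codeG p) i) = ⟨_, (codeG_spec p i).1⟩ from
      Fin.ext (Nat.mod_eq_of_lt (codeG_spec p i).1)] at h
  exists_iterate p i := (exists_iterateG p i).elim fun k h => ⟨k.1, h⟩
  complete := completeG

/-- The darts at the root. -/
theorem isRootPair_wheelRooted : IsRootPair (fun d : wheelRooted.graph.Dart => d.fst)
    wheelRooted.root (fun i => rotationTableG.dart (cond i 10 9)) where
  ne := rotationTableG.dart.injective.ne (by decide)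
  tail_eq_iff d := by
    obtain ⟨i, rfl⟩ := rotationTableG.dart.surjective d
    rw [rotationTableG.dart.apply_eq_iff_eq, rotationTableG.dart.apply_eq_iff_eq]
    change tailG i = 5 ↔ i = 9 ∨ i = 10
    revert i
    decide +kernel

/-- The number of faces of an embedding of `wheelRooted`. -/
def facesG (p : WheelRotation) : ℕ := countMinimal (fun i => digit (codeG p) (i ^^^ 1)) 20 18

/-- Whether two faces are incident on the root. -/
def twoFacesG (p : WheelRotation) : Bool :=
  !isIterate (fun i => digit (codeG p) (i ^^^ 1)) 10 20 9

/-- Number of faces and type of the root for the 96 embeddings. -/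
theorem statsG : Finset.univ.val.map (fun p => (facesG p, twoFacesG p)) =
    Multiset.replicate 2 (5, true) + Multiset.replicate 44 (3, true) +
      Multiset.replicate 14 (3, false) + Multiset.replicate 36 (1, false) := by
  decide +kernel

theorem hasGenus_wheelRooted_iff (p : WheelRotation) (k : ℕ) :
    HasGenus (rotationTableG.rotation p).1 k ↔ facesG p + 2 * k = 5 := by
  have h : numFaces (rotationTableG.rotation p).1 = facesG p :=
    rotationTableG.numCycles_eq (rotationTableG.facePerm_spec p)
  have hV : Nat.card wheelRooted.V = 6 := Nat.card_fin 6
  have := wheelRooted.finite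
  have := nat_card_edgeSet_of_dart dartG
  rw [HasGenus, h, hV]
  omega

theorem exists_hasGenus_wheelRooted (ρ : Perm wheelRooted.graph.Dart)
    (hρ : IsRotationSystem wheelRooted.graph ρ) : ∃ i, HasGenus ρ i := by
  obtain ⟨p, hp⟩ := rotationTableG.rotation.surjective ⟨ρ, hρ⟩
  have hρp : ρ = (rotationTableG.rotation p).1 := by rw [hp]
  have h := Multiset.mem_map_of_mem (fun p => (facesG p, twoFacesG p)) (Finset.mem_univ_val p)
  rw [statsG] at h
  simp only [Multiset.mem_add, Multiset.mem_replicate, Prod.mk.injEq] at h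
  refine ⟨(5 - facesG p) / 2, ?_⟩
  rw [hρp, hasGenus_wheelRooted_iff]
  omega

theorem partialCount_wheelRooted (t : Bool) (k : ℕ) :
    partialCount wheelRooted.graph wheelRooted.root t k =
      if t then (if k = 0 then 2 else if k = 1 then 44 else 0)
        else if k = 1 then 14 else if k = 2 then 36 else 0 := by
  have h1 : partialCount wheelRooted.graph wheelRooted.root t k =
      Nat.card {p : WheelRotation // facesG p + 2 * k = 5 ∧ twoFacesG p = t} := by
    refine (Nat.card_congr (rotationTableG.rotation.subtypeEquiv fun p => ?_)).symm
    rw [hasGenus_wheelRooted_iff, rootOnTwoFaces_iff isRootPair_wheelRooted,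
      rotationTableG.sameCycle_iff (rotationTableG.facePerm_spec p), ← Bool.coe_iff_coe, twoFacesG,
      Bool.not_eq_true, Bool.not_eq_true']
    exact Iff.rfl
  rw [h1, Nat.card_eq_fintype_card, Fintype.card_subtype, Finset.card_filter,
    sum_eq_of_map_eq statsG (fun v => if v.1 + 2 * k = 5 ∧ v.2 = t then 1 else 0)]
  simp only [Multiset.map_add, Multiset.map_replicate, Multiset.sum_add, Multiset.sum_replicate,
    smul_eq_mul]
  rcases k with _ | _ | _ | k <;> cases t <;> simp <;> omega

end Wheels

/-! ### Interlacing sequences -/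

section Interlacing

/-- The likelihood-ratio order: the quotients `b i / a i` are nondecreasing. -/
def RatioLE (a b : ℕ → ℕ) : Prop := ∀ i j, i ≤ j → a j * b i ≤ a i * b j

theorem shift_shift (j k : ℕ) (a : ℕ → ℕ) : shift j (shift k a) = shift (k + j) a := by
  funext i
  unfold shift
  split_ifs <;> first | omega | rfl | (congr 1; omega)

theorem shift_zero (a : ℕ → ℕ) : shift 0 a = a := by
  funext i
  simp [shift]

theorem RatioLE.shift {a b : ℕ → ℕ} (h : RatioLE a b) (k : ℕ) :
    RatioLE (shift k a) (shift k b) := by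
  intro i j hij
  unfold GraphEmbedding.shift
  by_cases hi : k ≤ i
  · rw [if_pos hi, if_pos hi, if_pos (hi.trans hij), if_pos (hi.trans hij)]
    exact h _ _ (Nat.sub_le_sub_right hij k)
  · simp [hi]

/-- Consecutive comparisons in a family of sequences compose, if the supports are intervals whose
end points move to the right. -/
theorem ratioLE_of_le {w : ℕ → ℕ → ℕ} {l r : ℕ → ℕ} (hl : Monotone l) (hr : Monotone r)
    (hw : ∀ u i, w u i ≠ 0 ↔ l u ≤ i ∧ i ≤ r u) (h : ∀ u, RatioLE (w u) (w (u + 1)))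
    {u v : ℕ} (huv : u ≤ v) : RatioLE (w u) (w v) := by
  induction v, huv using Nat.le_induction with
  | base => exact fun i j _ => (mul_comm _ _).le
  | succ v huv ih =>
    intro i j hij
    by_cases hj : w u j = 0
    · simp [hj]
    by_cases hi : w (v + 1) i = 0
    · simp [hi]
    -- Both indices lie in the support of the sequence in the middle.
    have hj' := (hw u j).1 hj
    have hi' := (hw (v + 1) i).1 hi
    have h1 : 0 < w v i := Nat.pos_of_ne_zero <| (hw v i).2
      ⟨(hl v.le_succ).trans hi'.1, hij.trans (hj'.2.trans (hr huv))⟩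
    have h2 : 0 < w v j := Nat.pos_of_ne_zero <| (hw v j).2
      ⟨(hl v.le_succ).trans (hi'.1.trans hij), hj'.2.trans (hr huv)⟩
    refine Nat.le_of_mul_le_mul_right ?_ (Nat.mul_pos h1 h2)
    calc w u j * w (v + 1) i * (w v i * w v j)
        = (w u j * w v i) * (w v j * w (v + 1) i) := by ring
      _ ≤ (w u i * w v j) * (w v i * w (v + 1) j) := Nat.mul_le_mul (ih i j hij) (h v i j hij)
      _ = w u i * w (v + 1) j * (w v i * w v j) := by ring

/-- The sequences `d` and `s` have the supports `[0, N]` and `[1, N + 1]`, and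
`d`, `s`, `x d` increase in the likelihood-ratio order. -/
structure Interlaced (N : ℕ) (d s : ℕ → ℕ) : Prop where
  ne_zero_left : ∀ i, d i ≠ 0 ↔ i ≤ N
  ne_zero_right : ∀ i, s i ≠ 0 ↔ 1 ≤ i ∧ i ≤ N + 1
  le : RatioLE d s
  le_shift : RatioLE s (shift 1 d)

/-- The sequences `d, s, x d, x s, x² d, …`. -/
def interleave (d s : ℕ → ℕ) (u : ℕ) : ℕ → ℕ := shift (u / 2) (if u % 2 = 0 then d else s)

theorem Interlaced.ratioLE_interleave {N : ℕ} {d s : ℕ → ℕ} (h : Interlaced N d s) {u v : ℕ}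
    (huv : u ≤ v) : RatioLE (interleave d s u) (interleave d s v) := by
  refine ratioLE_of_le (l := fun u => (u + 1) / 2) (r := fun u => N + (u + 1) / 2)
    (fun _ _ h => by dsimp only; omega) (fun _ _ h => by dsimp only; omega) (fun u i => ?_)
    (fun u => ?_) huv
  · have h1 := h.ne_zero_left (i - u / 2)
    have h2 := h.ne_zero_right (i - u / 2)
    unfold interleave shift
    split_ifs <;> omega
  · unfold interleave
    rcases Nat.even_or_odd' u with ⟨k, rfl | rfl⟩
    · rw [show 2 * k / 2 = k by omega, show (2 * k + 1) / 2 = k by omega, if_pos (by omega),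
        if_neg (by omega)]
      exact h.le.shift k
    · rw [show (2 * k + 1) / 2 = k by omega, show (2 * k + 1 + 1) / 2 = 1 + k by omega,
        if_neg (by omega), if_pos (by omega), ← shift_shift]
      exact h.le_shift.shift k

/-- The recursion of the partial genus distributions preserves interlacing: the rows
`(8, 12, 208, 264, 64, 0, 0)`, `(0, 0, 56, 84, 240, 216, 0)` and `(0, 0, 8, 12, 208, 264, 64)` of
coefficients have nonnegative minors of order 2, so that the claim follows from the
Cauchy–Binet formula. -/
theorem Interlaced.step {N : ℕ} {d s d' s' : ℕ → ℕ} (h : Interlaced N d s)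
    (hd : ∀ k, d' k = 8 * d k + 12 * s k + 208 * shift 1 d k + 264 * shift 1 s k +
      64 * shift 2 d k)
    (hs : ∀ k, s' k = 56 * shift 1 d k + 84 * shift 1 s k + 240 * shift 2 d k +
      216 * shift 2 s k) : Interlaced (N + 2) d' s' := by
  have hd0 := h.ne_zero_left
  have hs0 := h.ne_zero_right
  have hdk : ∀ k i, shift k d i ≠ 0 ↔ k ≤ i ∧ i ≤ N + k := fun k i => by
    have := hd0 (i - k)
    unfold shift
    split_ifs <;> omega
  have hsk : ∀ k i, shift k s i ≠ 0 ↔ k + 1 ≤ i ∧ i ≤ N + 1 + k := fun k i => by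
    have := hs0 (i - k)
    unfold shift
    split_ifs <;> omega
  have w0 : interleave d s 0 = d := shift_zero d
  have w1 : interleave d s 1 = s := shift_zero s
  have w2 : interleave d s 2 = shift 1 d := rfl
  have w3 : interleave d s 3 = shift 1 s := rfl
  have w4 : interleave d s 4 = shift 2 d := rfl
  have w5 : interleave d s 5 = shift 2 s := rfl
  have w6 : interleave d s 6 = shift 3 d := rfl
  have hd1 : ∀ k, shift 1 d' k = 8 * shift 1 d k + 12 * shift 1 s k + 208 * shift 2 d k +
      264 * shift 2 s k + 64 * shift 3 d k := by
    intro k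
    rw [← shift_shift 1 1 d, ← shift_shift 1 1 s, ← shift_shift 1 2 d]
    by_cases hk : 1 ≤ k
    · have e : ∀ a : ℕ → ℕ, shift 1 a k = a (k - 1) := fun a => if_pos hk
      rw [e, e, e, e, e, e, hd]
    · have e : ∀ a : ℕ → ℕ, shift 1 a k = 0 := fun a => if_neg hk
      rw [e, e, e, e, e, e]
  refine ⟨fun i => ?_, fun i => ?_, fun i j hij => ?_, fun i j hij => ?_⟩
  · have h1 := hdk 1 i
    have h2 := hsk 1 i
    have h3 := hdk 2 i
    have h4 := hd0 i
    have h5 := hs0 i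
    rw [hd]
    omega
  · have h1 := hdk 1 i
    have h2 := hsk 1 i
    have h3 := hdk 2 i
    have h4 := hsk 2 i
    rw [hs]
    omega
  · have m : ∀ u v, u ≤ v → _ := fun u v huv => h.ratioLE_interleave (u := u) (v := v) huv i j hij
    have m02 := m 0 2 (by decide)
    have m03 := m 0 3 (by decide)
    have m04 := m 0 4 (by decide)
    have m05 := m 0 5 (by decide)
    have m12 := m 1 2 (by decide)
    have m13 := m 1 3 (by decide)
    have m14 := m 1 4 (by decide)
    have m15 := m 1 5 (by decide)
    have m23 := m 2 3 (by decide)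
    have m24 := m 2 4 (by decide)
    have m25 := m 2 5 (by decide)
    have m34 := m 3 4 (by decide)
    have m35 := m 3 5 (by decide)
    have m45 := m 4 5 (by decide)
    simp only [w0, w1, w2, w3, w4, w5] at *
    rw [hd, hd, hs, hs]
    linarith
  · have m : ∀ u v, u ≤ v → _ := fun u v huv => h.ratioLE_interleave (u := u) (v := v) huv i j hij
    have m23 := m 2 3 (by decide)
    have m24 := m 2 4 (by decide)
    have m25 := m 2 5 (by decide)
    have m26 := m 2 6 (by decide)
    have m34 := m 3 4 (by decide)
    have m35 := m 3 5 (by decide)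
    have m36 := m 3 6 (by decide)
    have m45 := m 4 5 (by decide)
    have m46 := m 4 6 (by decide)
    have m56 := m 5 6 (by decide)
    simp only [w2, w3, w4, w5, w6] at *
    rw [hd1, hd1, hs, hs]
    linarith

theorem Interlaced.logConcave_left {N : ℕ} {d s : ℕ → ℕ} (h : Interlaced N d s) :
    LogConcave d := by
  intro k
  have := h.ratioLE_interleave (u := 0) (v := 2) (by decide) (k + 1) (k + 2) (by omega)
  simp [interleave, shift] at this
  nlinarith

theorem Interlaced.logConcave_right {N : ℕ} {d s : ℕ → ℕ} (h : Interlaced N d s) :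
    LogConcave s := by
  intro k
  have := h.ratioLE_interleave (u := 1) (v := 3) (by decide) (k + 1) (k + 2) (by omega)
  simp [interleave, shift] at this
  nlinarith

theorem Interlaced.synchronized {N : ℕ} {d s : ℕ → ℕ} (h : Interlaced N d s) :
    Synchronized d s := by
  refine ⟨h.logConcave_left, h.logConcave_right, fun k => ⟨?_, ?_⟩⟩
  · have := h.ratioLE_interleave (u := 1) (v := 2) (by decide) (k + 1) (k + 2) (by omega)
    simp [interleave, shift] at this
    linarith
  · have := h.ratioLE_interleave (u := 0) (v := 3) (by decide) (k + 1) (k + 2) (by omega)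
    simp [interleave, shift] at this
    linarith

theorem Synchronized.logConcave_add {a b : ℕ → ℕ} (h : Synchronized a b) :
    LogConcave fun k => a k + b k := by
  intro k
  have h1 := h.1 k
  have h2 := h.2.1 k
  have h3 := h.2.2 k
  dsimp only
  nlinarith

theorem noInternalZeros_of_support {a : ℕ → ℕ} {l r : ℕ} (h : ∀ i, a i ≠ 0 ↔ l ≤ i ∧ i ≤ r) :
    NoInternalZeros a := fun i k j hik hkj hi hj =>
  (h k).2 ⟨((h i).1 hi).1.trans hik.le, hkj.le.trans ((h j).1 hj).2⟩

end Interlacing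

/-! ### The wheel chains -/

theorem interlaced_wheelRooted : Interlaced 1
    (partialCount wheelRooted.graph wheelRooted.root true)
    (partialCount wheelRooted.graph wheelRooted.root false) := by
  have hd : ∀ k, partialCount wheelRooted.graph wheelRooted.root true k =
      if k = 0 then 2 else if k = 1 then 44 else 0 := partialCount_wheelRooted true
  have hs : ∀ k, partialCount wheelRooted.graph wheelRooted.root false k =
      if k = 1 then 14 else if k = 2 then 36 else 0 := partialCount_wheelRooted false
  refine ⟨fun i => ?_, fun i => ?_, fun i j hij => ?_, fun i j hij => ?_⟩
  · rw [hd]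
    split_ifs <;> omega
  · rw [hs]
    split_ifs <;> omega
  · rw [hd, hd, hs, hs]
    split_ifs <;> omega
  · simp only [shift, hd, hs]
    split_ifs <;> omega

theorem wheelChain_spec (n : ℕ) :
    (∃ a, IsRootPair (fun d : (wheelChain n).graph.Dart => d.fst) (wheelChain n).root a) ∧
    (∀ ρ, IsRotationSystem (wheelChain n).graph ρ → ∃ i, HasGenus ρ i) ∧
    Interlaced (2 * n + 1) (partialCount (wheelChain n).graph (wheelChain n).root true)
      (partialCount (wheelChain n).graph (wheelChain n).root false) := by
  induction n with
  | zero => exact ⟨⟨_, isRootPair_wheelRooted⟩, exists_hasGenus_wheelRooted, interlaced_wheelRooted⟩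
  | succ n ih =>
    classical
    obtain ⟨⟨a, ha⟩, hg, hI⟩ := ih
    exact ⟨⟨_, isRootPair_amalgamate _ _ isRootPair_sndRoot⟩,
      transferH.exists_hasGenus_amalgamate ha isRootPair_fstRoot isRootPair_sndRoot hg,
      hI.step (fun k => (partialCount_amalgamate_wheel ha hg k).1)
        fun k => (partialCount_amalgamate_wheel ha hg k).2⟩

end GraphEmbedding

open GraphEmbedding in
theorem mainTheorem3 (n : ℕ) :
    (LogConcave (genusDistribution (wheelChain n).graph) ∧
      NoInternalZeros (genusDistribution (wheelChain n).graph)) ∧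
    (LogConcave (partialD (wheelChain n).graph (wheelChain n).root) ∧
      NoInternalZeros (partialD (wheelChain n).graph (wheelChain n).root)) ∧
    (LogConcave (partialS (wheelChain n).graph (wheelChain n).root) ∧
      NoInternalZeros (partialS (wheelChain n).graph (wheelChain n).root)) ∧
    Synchronized (partialD (wheelChain n).graph (wheelChain n).root)
      (partialS (wheelChain n).graph (wheelChain n).root) := by
  have := (wheelChain n).finite
  have h := (wheelChain_spec n).2.2
  rw [← partialD_eq, ← partialS_eq] at h
  rw [genusDistribution_eq _ (wheelChain n).root]
  refine ⟨⟨h.synchronized.logConcave_add, ?_⟩, ⟨h.logConcave_left, ?_⟩,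
    ⟨h.logConcave_right, noInternalZeros_of_support h.ne_zero_right⟩, h.synchronized⟩
  · refine noInternalZeros_of_support (l := 0) (r := 2 * n + 2) fun i => ?_
    have h1 := h.ne_zero_left i
    have h2 := h.ne_zero_right i
    omega
  · refine noInternalZeros_of_support (l := 0) (r := 2 * n + 1) fun i => ?_
    rw [h.ne_zero_left]
    omega
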